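/- Let $d\in\{2,3\}$, let $k\ge 1$ be an integer and let $\mu>0$. Let $\Omega\subset\mathbb R^d$ be an open, bounded, connected domain with Lipschitz continuous boundary, and let $\mathcal T_h$ be a finite partition of $\Omega$ into polygons ($d=2$) or polyhedra ($d=3$) with flat sides (edges, resp. faces), every side being contained in $\partial\Omega$ or common to two elements. Write $h_T$, $h_e$ for the diameters of an element $T$ and of a side $e$, and $\mathbf n$ for the unit outward normal on $\partial T$. Assume that $\mathcal T_h$ is shape regular, i.e. that there are fixed positive constants $\varrho_v,\varrho_e,\kappa,\sigma_*,\gamma_*,\tau$, an angle $\theta_0\in[0,\pi/2)$ and an integer $m$ such that, for every element $T$ and every side $e$ of $T$: (A1) $\varrho_v h_T^d\le |T|$ and $\varrho_e h_e^{d-1}\le |e|$; (A2) $\kappa h_T\le h_e$; (A3) there is a pyramid contained in $T$ with base $e$, apex $A_e\in T$ and height $\sigma_e h_T$, $\sigma_e\ge\sigma_*$, such that for each $x_e\in e$ the angle between $x_e-A_e$ and the outward normal of $e$ is at most $\theta_0$; (A4) $T$ is contained in a simplex $S(T)$ which contains a ball of radius $\tau\,\mathrm{diam}\,S(T)$, with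 $\mathrm{diam}\,S(T)\le\gamma_* h_T$, and $S(T)$ meets at most $m$ of the simplices $S(T')$, $T'\ne T$. For a side $e$ let $V_{k-1}(e)=[P_{k-1}(e)]^d+P_{RM}(e)$, where $P_{RM}(e)$ consists of the restrictions to $e$ of the rigid motions $a+\eta x$, $a\in\mathbb R^d$, $\eta\in\mathbb R^{d\times d}$ skew-symmetric, and let $Q_b$ be the $L^2(e)$-projection onto $V_{k-1}(e)$ on each side $e$. Let $V_h$ be the space of pairs $v=\{v_0,v_b\}$ with $v_0|_T\in[P_k(T)]^d$ for each element $T$ and $v_b|_e\in V_{k-1}(e)$ (single-valued) for each side $e$, and let $V_h^0=\{v\in V_h: v_b=0\text{ on }\partial\Omega\}$. For $v\in V_h$ the discrete weak gradient $\nabla_w v$ is, on each element $T$, the unique element of $[P_{k-1}(T)]^{d\times d}$ with $$(\nabla_w v,\varphi)_T=-(v_0,\nabla\cdot\varphi)_T+\langle v_b,\varphi\mathbf n\rangle_{\partial T}\qquad\forall \varphi\in[P_{k-1}(T)]^{d\times d},$$ where $\nabla\cdot$ acts on rows. Put $\varepsilon_w(v)=\frac12(\nabla_w v+(\nabla_w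 v)^T)$, $\varepsilon(v_0)=\frac12(\nabla v_0+(\nabla v_0)^T)$, $$a(w,v)=2\sum_{T\in\mathcal T_h}(\mu\,\varepsilon_w(w),\varepsilon_w(v))_T+\sum_{T\in\mathcal T_h}h_T^{-1}\langle Q_bw_0-w_b,\,Q_bv_0-v_b\rangle_{\partial T},$$ $$|||v|||=\Big(\sum_{T\in\mathcal T_h}\|\varepsilon(v_0)\|_T^2+h_T^{-1}\|Q_bv_0-v_b\|_{\partial T}^2\Big)^{1/2}.$$ Then there exist positive constants $\alpha_1$ and $\alpha_2$, depending only on $d$, $k$, $\mu$, the shape regularity constants above and an upper bound for the number of sides of an element (in particular not on the mesh size), such that $$\alpha_1|||v|||^2\le a(v,v)\le\alpha_2|||v|||^2\qquad\forall\,v\in V_h^0.$$ -/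

import Mathlib

open MeasureTheory
open scoped NNReal Matrix

noncomputable section

namespace WG

/-- `ℝ^d` with the Euclidean norm. -/
abbrev Euc (d : ℕ) := EuclideanSpace ℝ (Fin d)

/-! ### Domains and partitions -/

/-- `Ω` has a Lipschitz boundary: near each boundary point, `Ω` is the region on one side of the
graph of a Lipschitz function, in the direction of some unit vector `ν`. -/
def HasLipschitzBoundary {d : ℕ} (Ω : Set (Euc d)) : Prop :=
  ∀ x ∈ frontier Ω, ∃ (ν : Euc d) (U : Set (Euc d)) (γ : Euc d → ℝ) (K : ℝ≥0),
    ‖ν‖ = 1 ∧ IsOpen U ∧ x ∈ U ∧ LipschitzWith K γ ∧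
      ∀ y ∈ U, (y ∈ Ω ↔ inner ℝ ν y < γ (y - (inner ℝ ν y) • ν))

/-- A (not necessarily convex) `m`-dimensional polytope in `ℝ^d`: a compact set spanning an
`m`-dimensional affine subspace, which is the closure of its (connected) interior relative to this
subspace and whose relative boundary is contained in finitely many proper affine subspaces of it.
For `m = 1, 2, 3` these are the segments, the flat polygons and the polyhedra. -/
structure IsPolytope {d : ℕ} (m : ℕ) (s : Set (Euc d)) : Prop where
  compact : IsCompact s
  dim : Module.finrank ℝ (affineSpan ℝ s).direction = m
  connected : IsConnected (intrinsicInterior ℝ s)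
  regular : s ⊆ closure (intrinsicInterior ℝ s)
  flat : ∃ F : Finset (AffineSubspace ℝ (Euc d)),
    (∀ Q ∈ F, Q < affineSpan ℝ s) ∧ intrinsicFrontier ℝ s ⊆ ⋃ Q ∈ F, (Q : Set (Euc d))

/-- `n` is the unit normal vector to the flat side `e` of `T`, pointing out of `T`. -/
def IsOutwardNormal {d : ℕ} (T e : Set (Euc d)) (n : Euc d) : Prop :=
  ‖n‖ = 1 ∧ (∀ x ∈ e, ∀ y ∈ e, inner ℝ n (y - x) = 0) ∧
    ∀ x ∈ intrinsicInterior ℝ e, ∃ δ : ℝ, 0 < δ ∧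
      ∀ s : ℝ, 0 < s → s < δ → x - s • n ∈ T ∧ x + s • n ∉ T

/-- The unit outward normal vector to `T` on its side `e`. -/
def outwardNormal {d : ℕ} (T e : Set (Euc d)) : Euc d :=
  Classical.epsilon (IsOutwardNormal T e)

/-- A finite collection of elements, together with the collection of their sides
(edges for `d = 2`, faces for `d = 3`). -/
structure Mesh (d : ℕ) where
  elements : Finset (Set (Euc d))
  sides : Finset (Set (Euc d))

open Classical in
/-- The sides of the element `T`: those which lie on its boundary. -/
def Mesh.sidesOf {d : ℕ} (M : Mesh d) (T : Set (Euc d)) : Finset (Set (Euc d)) :=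
  M.sides.filter (fun e => e ⊆ frontier T)

/-- `M` is a finite element partition of the domain `Ω` into polygons (`d = 2`) or polyhedra
(`d = 3`). Two elements may share only part of a geometric facet; this facet is then subdivided
into several sides, so that every side is either on the boundary of `Ω` or common to two elements
(this is forced by `frontier_eq` and `sides_disjoint`). -/
structure Mesh.IsPartition {d : ℕ} (M : Mesh d) (Ω : Set (Euc d)) : Prop where
  elements_polytope : ∀ T ∈ M.elements, IsPolytope d T
  sides_polytope : ∀ e ∈ M.sides, IsPolytope (d - 1) e
  covers : ⋃ T ∈ M.elements, T = closure Ω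
  interiors_disjoint : ∀ T ∈ M.elements, ∀ T' ∈ M.elements, T ≠ T' →
    Disjoint (interior T) (interior T')
  sides_disjoint : ∀ e ∈ M.sides, ∀ e' ∈ M.sides, e ≠ e' →
    Disjoint (intrinsicInterior ℝ e) (intrinsicInterior ℝ e')
  side_of_element : ∀ e ∈ M.sides, ∃ T ∈ M.elements, e ∈ M.sidesOf T
  frontier_eq : ∀ T ∈ M.elements, frontier T = ⋃ e ∈ M.sidesOf T, e
  exists_normal : ∀ T ∈ M.elements, ∀ e ∈ M.sidesOf T, ∃ n, IsOutwardNormal T e n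

/-! ### Shape regularity -/

/-- The diameter `h_s` of an element or a side. -/
abbrev size {d : ℕ} (s : Set (Euc d)) : ℝ := Metric.diam s

/-- The area (`d = 3`) or length (`d = 2`) measure on sides: the `(d-1)`-dimensional Hausdorff
measure, normalized to agree with Lebesgue measure on hyperplanes. -/
abbrev surf (d : ℕ) : Measure (Euc d) := Measure.euclideanHausdorffMeasure (d - 1)

/-- The constants that quantify shape regularity. -/
structure ShapeConstants where
  /-- lower bound for `|T| / h_T ^ d` -/
  rhoV : ℝ
  /-- lower bound for `|e| / h_e ^ (d - 1)` -/
  rhoE : ℝ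
  /-- lower bound for `h_e / h_T` -/
  kappa : ℝ
  /-- lower bound for the relative height of the pyramids -/
  sigma : ℝ
  /-- upper bound for the angle of the pyramids with the normal -/
  theta : ℝ
  /-- upper bound for the relative diameter of the circumscribed simplices -/
  gamma : ℝ
  /-- lower bound for the ratio of inradius and diameter of the circumscribed simplices -/
  tau : ℝ
  /-- upper bound for the number of simplices that meet a given one -/
  overlap : ℕ
  rhoV_pos : 0 < rhoV
  rhoE_pos : 0 < rhoE
  kappa_pos : 0 < kappa
  sigma_pos : 0 < sigma
  theta_nonneg : 0 ≤ theta
  theta_lt : theta < Real.pi / 2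
  gamma_pos : 0 < gamma
  tau_pos : 0 < tau

open Classical in
/-- Shape regularity of a polygonal or polyhedral partition. -/
structure Mesh.ShapeRegular {d : ℕ} (M : Mesh d) (c : ShapeConstants) : Prop where
  volume_ge : ∀ T ∈ M.elements, c.rhoV * size T ^ d ≤ volume.real T
  area_ge : ∀ e ∈ M.sides, c.rhoE * size e ^ (d - 1) ≤ (surf d).real e
  size_ge : ∀ T ∈ M.elements, ∀ e ∈ M.sidesOf T, c.kappa * size T ≤ size e
  /-- Each side `e` of `T` is the base of a pyramid contained in `T`, with apex `A` and with height
  `σ h_T`, `σ ≥ σ_*`, that stands up above its base. -/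
  pyramid : ∀ T ∈ M.elements, ∀ e ∈ M.sidesOf T, ∃ A ∈ T, ∃ σ : ℝ, c.sigma ≤ σ ∧
    convexJoin ℝ {A} e ⊆ T ∧
    ∀ x ∈ e, inner ℝ (outwardNormal T e) (x - A) = σ * size T ∧
      InnerProductGeometry.angle (x - A) (outwardNormal T e) ≤ c.theta
  /-- Each `T` has a shape regular circumscribed simplex `S T` of comparable diameter, and each of
  these simplices meets only a fixed number of others. -/
  simplex : ∃ S : Set (Euc d) → Set (Euc d),
    (∀ T ∈ M.elements,
      (∃ p : Fin (d + 1) → Euc d, AffineIndependent ℝ p ∧ S T = convexHull ℝ (Set.range p)) ∧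
      T ⊆ S T ∧ size (S T) ≤ c.gamma * size T ∧
      ∃ z : Euc d, Metric.closedBall z (c.tau * size (S T)) ⊆ S T) ∧
    ∀ T ∈ M.elements,
      (M.elements.filter (fun T' => T' ≠ T ∧ (S T ∩ S T').Nonempty)).card ≤ c.overlap

/-! ### Polynomial spaces and weak finite element functions -/

/-- `f` is a polynomial of degree at most `r` in `d` variables. -/
def IsPoly {d : ℕ} (r : ℕ) (f : Euc d → ℝ) : Prop :=
  ∃ p : MvPolynomial (Fin d) ℝ, p.totalDegree ≤ r ∧ ∀ x : Euc d, f x = MvPolynomial.eval (fun i => x i) p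

/-- `f ∈ [P_r]^d`. -/
def IsPolyVec {d : ℕ} (r : ℕ) (f : Euc d → Euc d) : Prop :=
  ∀ i, IsPoly r (fun x => f x i)

/-- `φ ∈ [P_r]^{d × d}`. -/
def IsPolyMat {d : ℕ} (r : ℕ) (φ : Euc d → Matrix (Fin d) (Fin d) ℝ) : Prop :=
  ∀ i j, IsPoly r (fun x => φ x i j)

/-- `f` is a rigid motion `x ↦ a + η x` with `η` skew-symmetric. -/
def IsRigidMotion {d : ℕ} (f : Euc d → Euc d) : Prop :=
  ∃ (a : Euc d) (η : Matrix (Fin d) (Fin d) ℝ), ηᵀ = -η ∧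
    ∀ x : Euc d, f x = a + Matrix.toEuclideanLin η x

/-- The restriction of `f` to the side `e` belongs to `V_r(e) = [P_r(e)]^d + P_RM(e)`. -/
def InSideSpace {d : ℕ} (r : ℕ) (e : Set (Euc d)) (f : Euc d → Euc d) : Prop :=
  ∃ p q : Euc d → Euc d, IsPolyVec r p ∧ IsRigidMotion q ∧ ∀ x ∈ e, f x = p x + q x

/-- A weak function `v = {v₀, v_b}` on a mesh: `v.inn T` is `v₀` on the element `T` and `v.bdy e` is
`v_b` on the side `e`; as it does not depend on the element, `v_b` is single-valued. -/
structure WeakFun (d : ℕ) where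
  inn : Set (Euc d) → Euc d → Euc d
  bdy : Set (Euc d) → Euc d → Euc d

/-- The space `V_h`. A polynomial on `T` is identified with the polynomial on `ℝ^d` that it
determines; only the values of `v.bdy e` on `e` matter. -/
def InV {d : ℕ} (k : ℕ) (M : Mesh d) (v : WeakFun d) : Prop :=
  (∀ T ∈ M.elements, IsPolyVec k (v.inn T)) ∧ ∀ e ∈ M.sides, InSideSpace (k - 1) e (v.bdy e)

/-- The space `V_h^0` of functions in `V_h` with `v_b = 0` on `∂Ω`. -/
def InV0 {d : ℕ} (k : ℕ) (Ω : Set (Euc d)) (M : Mesh d) (v : WeakFun d) : Prop :=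
  InV k M v ∧ ∀ e ∈ M.sides, e ⊆ frontier Ω → ∀ x ∈ e, v.bdy e x = 0

/-! ### Differential operators and projections -/

/-- The partial derivative `∂_i f`. -/
def pd {d : ℕ} (i : Fin d) (f : Euc d → ℝ) (x : Euc d) : ℝ :=
  fderiv ℝ f x (EuclideanSpace.single i 1)

/-- The row-wise divergence of a matrix-valued function. -/
def divMat {d : ℕ} (φ : Euc d → Matrix (Fin d) (Fin d) ℝ) (x : Euc d) : Euc d :=
  WithLp.toLp 2 (fun i => ∑ j, pd j (fun y => φ y i j) x)

/-- The strain tensor `ε(u) = (∇u + ∇uᵀ) / 2`. -/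
def strain {d : ℕ} (u : Euc d → Euc d) (x : Euc d) : Matrix (Fin d) (Fin d) ℝ :=
  Matrix.of (fun i j => (pd j (fun y => u y i) x + pd i (fun y => u y j) x) / 2)

/-- The Frobenius inner product of matrices. -/
def frob {d : ℕ} (A B : Matrix (Fin d) (Fin d) ℝ) : ℝ := ∑ i, ∑ j, A i j * B i j

/-- The `L²(T)` inner product of matrix-valued functions. -/
def ipElem {d : ℕ} (T : Set (Euc d)) (A B : Euc d → Matrix (Fin d) (Fin d) ℝ) : ℝ :=
  ∫ x in T, frob (A x) (B x)

/-- The `L²(e)` inner product of vector-valued functions on a side `e`. -/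
def ipSide {d : ℕ} (e : Set (Euc d)) (f g : Euc d → Euc d) : ℝ :=
  ∫ x in e, inner ℝ (f x) (g x) ∂(surf d)

/-- `G` is the discrete weak gradient of `v` on `T`: the polynomial in `[P_r(T)]^{d × d}` with
`(G, φ)_T = -(v₀, ∇·φ)_T + ⟨v_b, φ n⟩_{∂T}` for all `φ ∈ [P_r(T)]^{d × d}`. -/
def IsWeakGrad {d : ℕ} (r : ℕ) (M : Mesh d) (T : Set (Euc d)) (v : WeakFun d)
    (G : Euc d → Matrix (Fin d) (Fin d) ℝ) : Prop :=
  IsPolyMat r G ∧ ∀ φ : Euc d → Matrix (Fin d) (Fin d) ℝ, IsPolyMat r φ →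
    ipElem T G φ = -(∫ x in T, inner ℝ (v.inn T x) (divMat φ x)) +
      ∑ e ∈ M.sidesOf T,
        ipSide e (v.bdy e) (fun x => Matrix.toEuclideanLin (φ x) (outwardNormal T e))

/-- The discrete weak gradient `∇_{w,r,T} v`. -/
def weakGrad {d : ℕ} (r : ℕ) (M : Mesh d) (v : WeakFun d) (T : Set (Euc d)) :
    Euc d → Matrix (Fin d) (Fin d) ℝ :=
  Classical.epsilon (IsWeakGrad r M T v)

/-- The discrete weak strain tensor `ε_w(v) = (∇_w v + (∇_w v)ᵀ) / 2` on `T`. -/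
def weakStrain {d : ℕ} (r : ℕ) (M : Mesh d) (v : WeakFun d) (T : Set (Euc d)) (x : Euc d) :
    Matrix (Fin d) (Fin d) ℝ :=
  (1 / 2 : ℝ) • (weakGrad r M v T x + (weakGrad r M v T x)ᵀ)

/-- `w` is the `L²(e)` projection of `f` onto `V_r(e)`. -/
def IsSideProj {d : ℕ} (r : ℕ) (e : Set (Euc d)) (f w : Euc d → Euc d) : Prop :=
  InSideSpace r e w ∧ ∀ z : Euc d → Euc d, InSideSpace r e z → ipSide e (fun x => f x - w x) z = 0

/-- The `L²` projection `Q_b f` of `f` onto `V_r(e)`. -/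
def sideProj {d : ℕ} (r : ℕ) (e : Set (Euc d)) (f : Euc d → Euc d) : Euc d → Euc d :=
  Classical.epsilon (IsSideProj r e f)

/-! ### The bilinear form and the norm -/

/-- The jump `Q_b v₀ - v_b` on the side `e` of `T`. -/
def jump {d : ℕ} (k : ℕ) (v : WeakFun d) (T e : Set (Euc d)) (x : Euc d) : Euc d :=
  sideProj (k - 1) e (v.inn T) x - v.bdy e x

/-- The stabilizer `s(w, v) = ∑_T h_T⁻¹ ⟨Q_b w₀ - w_b, Q_b v₀ - v_b⟩_{∂T}`. -/
def stab {d : ℕ} (k : ℕ) (M : Mesh d) (w v : WeakFun d) : ℝ :=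
  ∑ T ∈ M.elements, (size T)⁻¹ * ∑ e ∈ M.sidesOf T, ipSide e (jump k w T e) (jump k v T e)

/-- `a(w, v) = 2 ∑_T (μ ε_w(w), ε_w(v))_T + s(w, v)`. -/
def bilinA {d : ℕ} (k : ℕ) (μ : ℝ) (M : Mesh d) (w v : WeakFun d) : ℝ :=
  2 * ∑ T ∈ M.elements,
      ipElem T (fun x => μ • weakStrain (k - 1) M w T x) (weakStrain (k - 1) M v T) +
    stab k M w v

/-- The (semi-)norm
`|||v||| = (∑_T (‖ε(v₀)‖_T² + h_T⁻¹ ‖Q_b v₀ - v_b‖_{∂T}²))^{1/2}`. -/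
def tripleNorm {d : ℕ} (k : ℕ) (M : Mesh d) (v : WeakFun d) : ℝ :=
  Real.sqrt (∑ T ∈ M.elements, (ipElem T (strain (v.inn T)) (strain (v.inn T)) +
    (size T)⁻¹ * ∑ e ∈ M.sidesOf T, ipSide e (jump k v T e) (jump k v T e)))

end WG

end

/-!
Integration by parts and the definitions of `∇_w` and of the projection `Q_b` give
`(∇_w v - ∇v₀, φ)_T = -∑_e ⟨Q_b v₀ - v_b, φ n⟩_e` for every matrix polynomial `φ` of degree `k - 1`,
because `φ n ∈ V_{k-1}(e)` on a flat side. Taking `φ = ∇_w v - ∇v₀` and bounding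
`‖φ‖_e² ≤ C h_T⁻¹ ‖φ‖_T²` by scaling to the pyramid over `e` yields
`‖ε_w(v) - ε(v₀)‖_T² ≤ C h_T⁻¹ ‖Q_b v₀ - v_b‖_{∂T}²`; both bounds follow from this estimate by the
triangle inequality.

The divergence theorem is needed on elements that may be neither convex nor simply connected. Let
`shadow_e` be the set of points from which the ray in a direction `v` meets the side `e`. Counting
the crossings of almost every line in direction `v` with `∂T` gives
`1_T = ∑_e sign(n_e ⬝ v) 1_{shadow_e}` almost everywhere, and on each shadow the theorem is the
fundamental theorem of calculus along these lines.
-/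

noncomputable section

namespace WG

open Filter Topology

lemma integral_Iio_fderiv_line {V : Type*} [NormedAddCommGroup V] [NormedSpace ℝ V]
    {f : V → ℝ} (hf : ContDiff ℝ 1 f) (hf' : HasCompactSupport f)
    {v : V} (hv : v ≠ 0) (y : V) : ∫ s in Set.Iio (0 : ℝ), fderiv ℝ f (y + s • v) v = f y := by
  have hderiv (s : ℝ) : deriv (fun s : ℝ => f (y + s • v)) s = fderiv ℝ f (y + s • v) v := by
    have hline : HasDerivAt (fun s : ℝ => y + s • v) v s := by
      simpa using ((hasDerivAt_id s).smul_const v).const_add y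
    exact ((hf.differentiable one_ne_zero _).hasFDerivAt.comp_hasDerivAt s hline).deriv
  have hclosed : IsClosedEmbedding (fun s : ℝ => y + s • v) :=
    (Homeomorph.addLeft y).isClosedEmbedding.comp (isClosedEmbedding_smul_left hv)
  have h := HasCompactSupport.integral_Iic_deriv_eq (f := fun s : ℝ => f (y + s • v))
    (hf.comp (by fun_prop)) (hf'.comp_isClosedEmbedding hclosed) 0
  simp only [hderiv, zero_smul, add_zero] at h
  rw [← integral_Iic_eq_integral_Iio, h]

section Hyperplane

variable {E : Type*} [NormedAddCommGroup E] [InnerProductSpace ℝ E]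

/-- The affine hyperplane through `p` with normal vector `n`. -/
def hyperplane (p n : E) : Set E := {x | inner ℝ n (x - p) = 0}

/-- The parametrization of `hyperplane p n` by the linear hyperplane orthogonal to `n`. -/
def hyperplaneChart (p n : E) (z : (ℝ ∙ n)ᗮ) : E := p + z

/-- Oblique coordinates on the whole space: a foot point on `hyperplane p n` and the displacement
from it in the direction `v`. -/
def obliqueChart (p n v : E) (q : ℝ × (ℝ ∙ n)ᗮ) : E := hyperplaneChart p n q.2 + q.1 • v

/-- The points from which the ray in the direction `v` meets `e`. -/
def shadow (v : E) (e : Set E) : Set E := {x | ∃ t : ℝ, 0 < t ∧ x + t • v ∈ e}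

lemma mem_hyperplane {p n x : E} : x ∈ hyperplane p n ↔ inner ℝ n (x - p) = 0 := Iff.rfl

lemma hyperplane_eq_mk' (p n : E) :
    hyperplane p n = (AffineSubspace.mk' p (ℝ ∙ n)ᗮ : Set E) := by
  ext x
  simp [mem_hyperplane, AffineSubspace.mem_mk',
    Submodule.mem_orthogonal_singleton_iff_inner_right]

lemma isometry_hyperplaneChart (p n : E) : Isometry (hyperplaneChart p n) :=
  (IsometryEquiv.addLeft p).isometry.comp isometry_subtype_coe

@[fun_prop]
lemma continuous_hyperplaneChart (p n : E) : Continuous (hyperplaneChart p n) :=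
  (isometry_hyperplaneChart p n).continuous

@[fun_prop]
lemma continuous_obliqueChart (p n v : E) : Continuous (obliqueChart p n v) := by
  unfold obliqueChart
  fun_prop

lemma range_hyperplaneChart (p n : E) : Set.range (hyperplaneChart p n) = hyperplane p n := by
  ext x
  rw [mem_hyperplane]
  constructor
  · rintro ⟨z, rfl⟩
    simpa [hyperplaneChart] using Submodule.mem_orthogonal_singleton_iff_inner_right.1 z.2
  · intro hx
    exact ⟨⟨x - p, Submodule.mem_orthogonal_singleton_iff_inner_right.2 hx⟩,
      by simp [hyperplaneChart]⟩

lemma inner_obliqueChart_sub (p n v : E) (q : ℝ × (ℝ ∙ n)ᗮ) :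
    inner ℝ n (obliqueChart p n v q - p) = q.1 * inner ℝ n v := by
  have hq := Submodule.mem_orthogonal_singleton_iff_inner_right.1 q.2.2
  simp only [obliqueChart, hyperplaneChart, inner_sub_right, inner_add_right, inner_smul_right, hq]
  ring

lemma obliqueChart_add_smul (p n v : E) (q : ℝ × (ℝ ∙ n)ᗮ) (t : ℝ) :
    obliqueChart p n v q + t • v = obliqueChart p n v (q.1 + t, q.2) := by
  simp only [obliqueChart, add_smul, add_assoc]

lemma obliqueChart_mul_smul (A n : E) (H t : ℝ) (z : (ℝ ∙ n)ᗮ) :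
    obliqueChart A n n (H * t, t • z) =
      AffineMap.lineMap A (hyperplaneChart (A + H • n) n z) t := by
  simp only [obliqueChart, hyperplaneChart, AffineMap.lineMap_apply_module', Submodule.coe_smul,
    add_assoc, add_sub_cancel_left, smul_add, smul_smul, mul_comm H t]
  abel

lemma obliqueChart_injective (p : E) {n v : E} (hv : inner ℝ n v ≠ 0) :
    Function.Injective (obliqueChart p n v) := by
  intro q q' h
  have hfst : q.1 = q'.1 := mul_right_cancel₀ hv <| by
    rw [← inner_obliqueChart_sub p, ← inner_obliqueChart_sub p, h]
  have hsnd : q.2 = q'.2 := by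
    simp only [obliqueChart, hfst] at h
    exact (isometry_hyperplaneChart p n).injective (add_right_cancel h)
  exact Prod.ext hfst hsnd

lemma obliqueChart_preimage_shadow {p n v : E} (hv : inner ℝ n v ≠ 0) {e : Set E}
    (he : e ⊆ hyperplane p n) :
    obliqueChart p n v ⁻¹' shadow v e = Set.Iio 0 ×ˢ (hyperplaneChart p n ⁻¹' e) := by
  ext ⟨s, z⟩
  simp only [shadow, Set.mem_preimage, Set.mem_ofPred_eq, Set.mem_prod, Set.mem_Iio,
    obliqueChart_add_smul]
  constructor
  · rintro ⟨t, ht, hx⟩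
    have hst : s + t = 0 := by
      have h := he hx
      rw [mem_hyperplane, inner_obliqueChart_sub] at h
      exact (mul_eq_zero.1 h).resolve_right hv
    refine ⟨by linarith, ?_⟩
    simpa [obliqueChart, hst] using hx
  · rintro ⟨hs, hx⟩
    exact ⟨-s, by linarith, by simpa [obliqueChart] using hx⟩

lemma shadow_subset_range_obliqueChart {p n v : E} {e : Set E} (he : e ⊆ hyperplane p n) :
    shadow v e ⊆ Set.range (obliqueChart p n v) := by
  rintro x ⟨t, -, hx⟩
  obtain ⟨z, hz⟩ : x + t • v ∈ Set.range (hyperplaneChart p n) := by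
    rw [range_hyperplaneChart]
    exact he hx
  exact ⟨(-t, z), by simp [obliqueChart, hz]⟩

variable [FiniteDimensional ℝ E]

lemma finrank_orthogonal_span_singleton_eq_sub_one {n : E} (hn : n ≠ 0) :
    Module.finrank ℝ (ℝ ∙ n)ᗮ = Module.finrank ℝ E - 1 := by
  have h := (ℝ ∙ n).finrank_add_finrank_orthogonal
  rw [finrank_span_singleton hn] at h
  omega

variable [MeasurableSpace E] [BorelSpace E]

/-- The area measure on hypersurfaces: the Hausdorff measure of codimension one, normalized to agree
with Lebesgue measure on hyperplanes. -/
def area : Measure E := Measure.euclideanHausdorffMeasure (Module.finrank ℝ E - 1)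

lemma area_eq_surf (d : ℕ) : (area : Measure (Euc d)) = surf d := by
  rw [area, finrank_euclideanSpace_fin]

lemma measurableEmbedding_hyperplaneChart (p n : E) : MeasurableEmbedding (hyperplaneChart p n) :=
  (isometry_hyperplaneChart p n).isClosedEmbedding.measurableEmbedding

lemma measurableEmbedding_obliqueChart (p : E) {n v : E} (hv : inner ℝ n v ≠ 0) :
    MeasurableEmbedding (obliqueChart p n v) :=
  (continuous_obliqueChart p n v).measurableEmbedding (obliqueChart_injective p hv)

lemma map_hyperplaneChart_volume (p : E) {n : E} (hn : n ≠ 0) :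
    Measure.map (hyperplaneChart p n) volume = area.restrict (hyperplane p n) := by
  rw [area, ← range_hyperplaneChart, ← (isometry_hyperplaneChart p n).map_euclideanHausdorffMeasure,
    ← InnerProductSpace.euclideanHausdorffMeasure_eq_volume,
    finrank_orthogonal_span_singleton_eq_sub_one hn]

lemma area_restrict_eq_map {p n : E} (hn : n ≠ 0) {e : Set E} (he : e ⊆ hyperplane p n)
    (hm : MeasurableSet e) :
    area.restrict e = (volume.restrict (hyperplaneChart p n ⁻¹' e)).map (hyperplaneChart p n) := by
  rw [← (measurableEmbedding_hyperplaneChart p n).restrict_map, map_hyperplaneChart_volume p hn,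
    Measure.restrict_restrict hm, Set.inter_eq_left.2 he]

lemma area_lt_top {p n : E} (hn : n ≠ 0) {e : Set E} (he : e ⊆ hyperplane p n)
    (hc : IsCompact e) : area e < ⊤ := by
  have hpre : IsCompact (hyperplaneChart p n ⁻¹' e) :=
    (isometry_hyperplaneChart p n).isClosedEmbedding.isCompact_preimage hc
  rw [← Measure.restrict_apply_univ, area_restrict_eq_map hn he hc.measurableSet,
    (measurableEmbedding_hyperplaneChart p n).map_apply]
  simpa using hpre.measure_lt_top

lemma volume_hyperplane (p : E) {n : E} (hn : n ≠ 0) : volume (hyperplane p n) = 0 := by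
  rw [hyperplane_eq_mk']
  refine Measure.addHaar_affineSubspace volume _ fun htop => ?_
  have hmem : p + n ∈ AffineSubspace.mk' p (ℝ ∙ n)ᗮ := by rw [htop]; trivial
  rw [AffineSubspace.mem_mk', vsub_eq_sub, add_sub_cancel_left,
    Submodule.mem_orthogonal_singleton_iff_inner_right] at hmem
  exact hn (inner_self_eq_zero.1 hmem)

lemma measurableSet_shadow {p n v : E} (hv : inner ℝ n v ≠ 0) {e : Set E}
    (he : e ⊆ hyperplane p n) (hm : MeasurableSet e) : MeasurableSet (shadow v e) := by
  rw [← Set.image_preimage_eq_of_subset (shadow_subset_range_obliqueChart he),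
    (measurableEmbedding_obliqueChart p hv).measurableSet_image,
    obliqueChart_preimage_shadow hv he]
  exact measurableSet_Iio.prod ((measurableEmbedding_hyperplaneChart p n).measurable hm)

lemma measurePreserving_obliqueChart_self (p : E) {n : E} (hn : ‖n‖ = 1) :
    MeasurePreserving (obliqueChart p n n) volume volume := by
  have hprod := (ℝ ∙ n).measurePreserving_measurableEquivProd p
  rw [InnerProductSpace.euclideanHausdorffMeasure_eq_volume] at hprod
  have hline := (LinearIsometryEquiv.toSpanUnitSingleton (𝕜 := ℝ) n hn).measurePreserving
  convert! hprod.symm.comp (hline.prod (MeasurePreserving.id (volume : Measure (ℝ ∙ n)ᗮ))) using 1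
  ext1 q
  simp [obliqueChart, hyperplaneChart, Submodule.measurableEquivProd_symm_apply]
  abel

lemma map_mul_fst_volume (n : E) {c : ℝ} (hc : c ≠ 0) :
    Measure.map (fun q : ℝ × (ℝ ∙ n)ᗮ => (c * q.1, q.2)) volume =
      ENNReal.ofReal |c|⁻¹ • (volume : Measure (ℝ × (ℝ ∙ n)ᗮ)) := by
  have h := Measure.map_prod_map (volume : Measure ℝ) (volume : Measure (ℝ ∙ n)ᗮ)
    (f := fun s => c * s) (g := id) (by fun_prop) measurable_id
  rw [Real.map_volume_mul_left hc, Measure.map_id, Measure.prod_smul_left, abs_inv] at h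
  exact h.symm

lemma measurePreserving_shear {n : E} (w : (ℝ ∙ n)ᗮ) :
    MeasurePreserving (fun q : ℝ × (ℝ ∙ n)ᗮ => (q.1, q.2 + q.1 • w)) volume volume := by
  refine (MeasurePreserving.id (volume : Measure ℝ)).skew_product
    (g := fun s z => z + s • w) (by fun_prop) ?_
  exact Eventually.of_forall fun s => (measurePreserving_add_right volume (s • w)).map_eq

lemma map_obliqueChart_volume (p : E) {n v : E} (hn : ‖n‖ = 1) (hv : inner ℝ n v ≠ 0) :
    Measure.map (obliqueChart p n v) volume =
      ENNReal.ofReal |inner ℝ n v|⁻¹ • (volume : Measure E) := by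
  let c : ℝ := inner ℝ n v
  have htangent : v - c • n ∈ (ℝ ∙ n)ᗮ := by
    rw [Submodule.mem_orthogonal_singleton_iff_inner_right, inner_sub_right, inner_smul_right,
      real_inner_self_eq_norm_sq, hn]
    simp [c]
  let w : (ℝ ∙ n)ᗮ := ⟨v - c • n, htangent⟩
  have hcomp : obliqueChart p n v = obliqueChart p n n ∘ (fun q => (c * q.1, q.2)) ∘
      (fun q => (q.1, q.2 + q.1 • w)) := by
    ext1 q
    simp only [obliqueChart, hyperplaneChart, Function.comp, w, Submodule.coe_add,
      Submodule.coe_smul, smul_sub, smul_smul, mul_comm c]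
    abel
  rw [hcomp, ← Measure.map_map (by fun_prop) (by fun_prop),
    ← Measure.map_map (by fun_prop) (by fun_prop), (measurePreserving_shear w).map_eq,
    map_mul_fst_volume n hv, Measure.map_smul, (measurePreserving_obliqueChart_self p hn).map_eq]

lemma integrable_fderiv_apply {f : E → ℝ} (hf : ContDiff ℝ 1 f) (hf' : HasCompactSupport f)
    (v : E) : Integrable (fun x => fderiv ℝ f x v) :=
  ((hf.continuous_fderiv one_ne_zero).clm_apply continuous_const).integrable_of_hasCompactSupport
    ((hf'.fderiv (𝕜 := ℝ)).comp_left (g := fun L : E →L[ℝ] ℝ => L v) rfl)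

lemma setIntegral_shadow_fderiv {p n v : E} (hn : ‖n‖ = 1) (hv : inner ℝ n v ≠ 0)
    {e : Set E} (he : e ⊆ hyperplane p n) (hm : MeasurableSet e)
    {f : E → ℝ} (hf : ContDiff ℝ 1 f) (hf' : HasCompactSupport f) :
    ∫ x in shadow v e, fderiv ℝ f x v = |inner ℝ n v| * ∫ x in e, f x ∂area := by
  have hn0 : n ≠ 0 := fun h => by simp [h] at hn
  have hv0 : v ≠ 0 := fun h => by simp [h] at hv
  have hemb := measurableEmbedding_obliqueChart p hv
  have hmap := map_obliqueChart_volume p hn hv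
  have hint : Integrable ((fun x => fderiv ℝ f x v) ∘ obliqueChart p n v) volume := by
    rw [← hemb.integrable_map_iff, hmap]
    exact (integrable_fderiv_apply hf hf' v).smul_measure ENNReal.ofReal_ne_top
  have hfubini : ∫ q in Set.Iio (0 : ℝ) ×ˢ (hyperplaneChart p n ⁻¹' e),
      fderiv ℝ f (obliqueChart p n v q) v =
      ∫ z in hyperplaneChart p n ⁻¹' e, f (hyperplaneChart p n z) := by
    have hi := hint.integrableOn (s := Set.Iio (0 : ℝ) ×ˢ (hyperplaneChart p n ⁻¹' e))
    rw [IntegrableOn, Measure.volume_eq_prod, ← Measure.prod_restrict] at hi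
    rw [Measure.volume_eq_prod, ← Measure.prod_restrict]
    exact (integral_prod_symm _ hi).trans (integral_congr_ae (Eventually.of_forall fun z =>
      integral_Iio_fderiv_line hf hf' hv0 (hyperplaneChart p n z)))
  have hscaled : |inner ℝ n v|⁻¹ * ∫ x in shadow v e, fderiv ℝ f x v = ∫ x in e, f x ∂area := by
    rw [area_restrict_eq_map hn0 he hm, (measurableEmbedding_hyperplaneChart p n).integral_map,
      ← hfubini, ← obliqueChart_preimage_shadow hv he,
      ← hemb.setIntegral_map (fun x => fderiv ℝ f x v), hmap,
      Measure.restrict_smul, integral_smul_measure, ENNReal.toReal_ofReal (by positivity),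
      smul_eq_mul]
  rw [← hscaled, mul_inv_cancel_left₀ (abs_ne_zero.2 hv)]

end Hyperplane

section Pyramid

lemma lintegral_eq_pow_mul_lintegral_smul {V : Type*} [NormedAddCommGroup V] [NormedSpace ℝ V]
    [FiniteDimensional ℝ V] [MeasurableSpace V] [BorelSpace V] (ν : Measure V) [ν.IsAddHaarMeasure]
    {r : ℝ} (hr : 0 < r) {g : V → ENNReal} (hg : Measurable g) :
    ∫⁻ z, g z ∂ν = ENNReal.ofReal (r ^ Module.finrank ℝ V) * ∫⁻ z, g (r • z) ∂ν := by
  have hpow : 0 < r ^ Module.finrank ℝ V := by positivity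
  rw [← lintegral_map (g := fun z => r • z) hg (by fun_prop), Measure.map_addHaar_smul ν hr.ne',
    lintegral_smul_measure, smul_eq_mul, ← mul_assoc, ← ENNReal.ofReal_mul hpow.le,
    abs_of_pos (inv_pos.2 hpow), mul_inv_cancel₀ hpow.ne', ENNReal.ofReal_one, one_mul]

variable {E : Type*} [NormedAddCommGroup E] [InnerProductSpace ℝ E] [FiniteDimensional ℝ E]
  [MeasurableSpace E] [BorelSpace E]

lemma lintegral_eq_mul_lintegral_slices (A : E) {n : E} (hn : ‖n‖ = 1) {H : ℝ} (hH : 0 < H)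
    {G : E → ENNReal} (hG : Measurable G) :
    ∫⁻ x, G x =
      ENNReal.ofReal H * ∫⁻ t : ℝ, ∫⁻ z : (ℝ ∙ n)ᗮ, G (obliqueChart A n n (H * t, z)) := by
  have hGm : Measurable fun q => G (obliqueChart A n n q) :=
    hG.comp (continuous_obliqueChart A n n).measurable
  rw [← (measurePreserving_obliqueChart_self A hn).lintegral_comp hG, Measure.volume_eq_prod,
    lintegral_prod _ hGm.aemeasurable]
  simpa using lintegral_eq_pow_mul_lintegral_smul volume hH hGm.lintegral_prod_right'

lemma lintegral_pyramid_le {A n : E} (hn : ‖n‖ = 1) {H : ℝ} (hH : 0 < H) {e T : Set E}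
    (he : ∀ x ∈ e, inner ℝ n (x - A) = H) (hm : MeasurableSet e) (hT : MeasurableSet T)
    (hpyramid : convexJoin ℝ {A} e ⊆ T) {F : E → ENNReal} (hF : Measurable F) :
    ENNReal.ofReal H * ∫⁻ y in e, (∫⁻ t in Set.Ioo (0 : ℝ) 1,
      ENNReal.ofReal (t ^ (Module.finrank ℝ E - 1)) * F (AffineMap.lineMap A y t)) ∂area ≤
        ∫⁻ x in T, F x := by
  have hn0 : n ≠ 0 := fun h => by simp [h] at hn
  have hbase : e ⊆ hyperplane (A + H • n) n := fun x hx => by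
    simp [mem_hyperplane, ← sub_sub, inner_sub_right _ _ (H • n), he x hx, inner_smul_right, hn]
  have hGm : Measurable (T.indicator F) := hF.indicator hT
  have hchart := measurableEmbedding_hyperplaneChart (A + H • n) n
  have hslice (t : ℝ) : Measurable fun z => T.indicator F (obliqueChart A n n (H * t, z)) := by
    fun_prop
  have hcone {t : ℝ} (ht : t ∈ Set.Ioo (0 : ℝ) 1) {z : (ℝ ∙ n)ᗮ}
      (hz : hyperplaneChart (A + H • n) n z ∈ e) :
      F (AffineMap.lineMap A (hyperplaneChart (A + H • n) n z) t) =
        T.indicator F (obliqueChart A n n (H * t, t • z)) := by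
    have hmem : AffineMap.lineMap A (hyperplaneChart (A + H • n) n z) t ∈ convexJoin ℝ {A} e := by
      rw [mem_convexJoin]
      refine ⟨A, Set.mem_singleton A, _, hz, ?_⟩
      rw [segment_eq_image_lineMap]
      exact Set.mem_image_of_mem _ (Set.Ioo_subset_Icc_self ht)
    rw [obliqueChart_mul_smul, Set.indicator_of_mem (hpyramid hmem)]
  rw [← lintegral_indicator hT, lintegral_eq_mul_lintegral_slices A hn hH hGm,
    area_restrict_eq_map hn0 hbase hm, hchart.lintegral_map,
    lintegral_lintegral_swap (by fun_prop)]
  gcongr ENNReal.ofReal H * ?_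
  refine LE.le.trans ?_ (setLIntegral_le_lintegral (Set.Ioo (0 : ℝ) 1) _)
  refine setLIntegral_mono' measurableSet_Ioo fun t ht => ?_
  rw [lintegral_eq_pow_mul_lintegral_smul volume ht.1 (hslice t),
    finrank_orthogonal_span_singleton_eq_sub_one hn0, lintegral_const_mul _ (by fun_prop)]
  gcongr ENNReal.ofReal _ * ?_
  refine LE.le.trans ?_ (setLIntegral_le_lintegral (hyperplaneChart (A + H • n) n ⁻¹' e) _)
  exact setLIntegral_mono' (hchart.measurable hm) fun z hz => (hcone ht hz).le

end Pyramid

section Topology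

lemma eventually_mem_iff_of_notMem_frontier {X : Type*} [TopologicalSpace X] {T : Set X} {x : X}
    (hx : x ∉ frontier T) : ∀ᶠ y in 𝓝 x, (y ∈ T ↔ x ∈ T) := by
  rw [← Set.mem_compl_iff, compl_frontier_eq_union_interior] at hx
  rcases hx with h | h
  · filter_upwards [mem_interior_iff_mem_nhds.1 h] with y hy
      using iff_of_true hy (interior_subset h)
  · filter_upwards [mem_interior_iff_mem_nhds.1 h] with y hy
      using iff_of_false hy (interior_subset h)

lemma subset_of_disjoint_frontier {X : Type*} [TopologicalSpace X] {B T : Set X}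
    (hB : IsPreconnected B) (hfr : Disjoint B (frontier T)) (hBT : (B ∩ T).Nonempty) : B ⊆ T := by
  have hcover : B ⊆ interior T ∪ interior Tᶜ := by
    rw [← compl_frontier_eq_union_interior]
    exact hfr.subset_compl_right
  have hdisj : Disjoint (interior T) (interior Tᶜ) :=
    disjoint_compl_right.mono interior_subset interior_subset
  obtain ⟨z, hzB, hzT⟩ := hBT
  have hz : z ∈ interior T := (hcover hzB).resolve_right fun h => interior_subset h hzT
  exact (hB.subset_left_of_subset_union isOpen_interior isOpen_interior hdisj hcover
    ⟨z, hzB, hz⟩).trans interior_subset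

lemma eq_zero_of_eventually_const {D : ℝ → ℝ} (h : ∀ t, ∃ c, ∀ᶠ s in 𝓝[≠] t, D s = c)
    (h0 : ∀ᶠ s in atTop, D s = 0) {t₀ : ℝ} (ht : ∀ᶠ s in 𝓝 t₀, D s = D t₀) : D t₀ = 0 := by
  choose c hc using h
  have huniq (t a : ℝ) (ha : ∀ᶠ s in 𝓝[≠] t, D s = a) : c t = a := by
    obtain ⟨s, hs, hsa⟩ := ((hc t).and ha).exists
    rw [← hs, hsa]
  have huniq' (t a : ℝ) (ha : ∀ᶠ s in 𝓝 t, D s = a) : c t = a :=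
    huniq t a (eventually_nhdsWithin_of_eventually_nhds ha)
  have hlocal : IsLocallyConstant c := by
    rw [IsLocallyConstant.iff_eventually_eq]
    intro t
    have hnear := eventually_eventually_nhds.2 (eventually_nhdsWithin_iff.1 (hc t))
    filter_upwards [hnear] with s hs
    by_cases hst : s = t
    · rw [hst]
    · refine huniq' s _ ?_
      filter_upwards [hs, isOpen_ne.mem_nhds hst] with s' hs' hne using hs' hne
  obtain ⟨R, hR⟩ := eventually_atTop.1 h0
  have hend : c (R + 1) = 0 := huniq' _ _ <| by
    filter_upwards [lt_mem_nhds (lt_add_one R)] with s hs using hR s hs.le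
  rw [← huniq' t₀ (D t₀) ht, ← hend]
  exact hlocal.apply_eq_of_isPreconnected isPreconnected_univ (Set.mem_univ _) (Set.mem_univ _)

end Topology

section Shadow

variable {E : Type*} [NormedAddCommGroup E] [InnerProductSpace ℝ E]

lemma add_smul_mem_shadow_iff {v x : E} {e : Set E} {t : ℝ} :
    x + t • v ∈ shadow v e ↔ ∃ u, t < u ∧ x + u • v ∈ e := by
  simp only [shadow, Set.mem_ofPred_eq, add_assoc, ← add_smul]
  exact ⟨fun ⟨u, hu, h⟩ => ⟨t + u, by linarith, h⟩,
    fun ⟨u, hu, h⟩ => ⟨u - t, by linarith, by rwa [add_sub_cancel]⟩⟩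

lemma eventually_mem_shadow_iff {v x : E} {e : Set E} (he : IsClosed e) {t : ℝ}
    (ht : x + t • v ∉ e) : ∀ᶠ s in 𝓝 t, (x + s • v ∈ shadow v e ↔ x + t • v ∈ shadow v e) := by
  have hcont : Continuous fun s : ℝ => x + s • v := by fun_prop
  obtain ⟨r, hr, hball⟩ := Metric.mem_nhds_iff.1
    (hcont.continuousAt.preimage_mem_nhds (he.isOpen_compl.mem_nhds ht))
  have hfar {u : ℝ} (hu : x + u • v ∈ e) : r ≤ |u - t| := by
    by_contra! hlt
    exact hball (by simpa [Real.dist_eq] using hlt) hu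
  filter_upwards [Metric.ball_mem_nhds t hr] with s hs
  rw [Metric.mem_ball, Real.dist_eq, abs_lt] at hs
  simp only [add_smul_mem_shadow_iff]
  constructor <;> rintro ⟨u, hu, hue⟩ <;> refine ⟨u, ?_, hue⟩ <;>
    rcases le_abs'.1 (hfar hue) with h | h <;> linarith

lemma add_smul_mem_shadow_iff_lt {v x n : E} {e : Set E} {t : ℝ}
    (he : ∀ y ∈ e, ∀ z ∈ e, inner ℝ n (z - y) = 0) (hv : inner ℝ n v ≠ 0) (ht : x + t • v ∈ e)
    (s : ℝ) : x + s • v ∈ shadow v e ↔ s < t := by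
  rw [add_smul_mem_shadow_iff]
  constructor
  · rintro ⟨u, hu, hue⟩
    have h := he _ ht _ hue
    rw [add_sub_add_left_eq_sub, ← sub_smul, inner_smul_right] at h
    linarith [(mul_eq_zero.1 h).resolve_right hv]
  · exact fun hs => ⟨t, hs, ht⟩

end Shadow

section GenericLines

lemma ae_line_notMem_affineSubspace {E : Type*} [NormedAddCommGroup E] [NormedSpace ℝ E]
    [FiniteDimensional ℝ E] [MeasurableSpace E] [BorelSpace E] (ν : Measure E) [ν.IsAddHaarMeasure]
    (v : E) {Q : AffineSubspace ℝ E}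
    (hQ : (Q : Set E).Nonempty → Module.finrank ℝ Q.direction + 1 < Module.finrank ℝ E) :
    ∀ᵐ x ∂ν, ∀ t : ℝ, x + t • v ∉ Q := by
  rcases (Q : Set E).eq_empty_or_nonempty with hempty | ⟨q, hq⟩
  · exact Eventually.of_forall fun x t hx =>
      Set.notMem_empty _ (hempty ▸ hx : x + t • v ∈ (∅ : Set E))
  let Q' : AffineSubspace ℝ E := AffineSubspace.mk' q (Q.direction ⊔ ℝ ∙ v)
  have hQ' : Q' ≠ ⊤ := fun htop => by
    have hdir : Q.direction ⊔ ℝ ∙ v = ⊤ := by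
      rw [← AffineSubspace.direction_mk' q (Q.direction ⊔ ℝ ∙ v),
        ← AffineSubspace.direction_top ℝ E E]
      exact congrArg AffineSubspace.direction htop
    have hadd := Submodule.finrank_add_le_finrank_add_finrank Q.direction (ℝ ∙ v)
    have hline := finrank_span_le_card (R := ℝ) ({v} : Set E)
    rw [hdir, finrank_top] at hadd
    simp only [Set.toFinset_singleton, Finset.card_singleton] at hline
    have := hQ ⟨q, hq⟩
    omega
  refine measure_mono_null (fun x hx => ?_) (Measure.addHaar_affineSubspace ν Q' hQ')
  simp only [Set.mem_compl_iff, Set.mem_ofPred_eq, not_forall, not_not] at hx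
  obtain ⟨t, ht⟩ := hx
  refine (AffineSubspace.mem_mk' (p := q) (direction := Q.direction ⊔ ℝ ∙ v)).2 ?_
  have hsplit : x -ᵥ q = (x + t • v - q) + (-t) • v := by
    rw [vsub_eq_sub, neg_smul]
    abel
  rw [hsplit]
  exact Submodule.add_mem_sup (AffineSubspace.vsub_mem_direction ht hq)
    (Submodule.smul_mem _ _ (Submodule.mem_span_singleton_self v))

variable {d : ℕ}

lemma IsPolytope.nonempty {m : ℕ} {s : Set (Euc d)} (hs : IsPolytope m s) : s.Nonempty :=
  hs.connected.nonempty.mono intrinsicInterior_subset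

lemma IsPolytope.ae_line_notMem_intrinsicFrontier {e : Set (Euc d)} (he : IsPolytope (d - 1) e)
    (v : Euc d) : ∀ᵐ x : Euc d, ∀ t : ℝ, x + t • v ∉ intrinsicFrontier ℝ e := by
  obtain ⟨F, hF, hsub⟩ := he.flat
  have hlines : ∀ᵐ x : Euc d, ∀ Q ∈ F, ∀ t : ℝ, x + t • v ∉ Q := by
    rw [Finset.eventually_all]
    refine fun Q hQ => ae_line_notMem_affineSubspace volume v fun hne => ?_
    have hlt := Submodule.finrank_lt_finrank_of_lt
      (AffineSubspace.direction_lt_of_nonempty (hF Q hQ) hne)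
    rw [he.dim] at hlt
    rw [finrank_euclideanSpace_fin]
    omega
  filter_upwards [hlines] with x hx t hxt
  obtain ⟨Q, hQ, hxQ⟩ := Set.mem_iUnion₂.1 (hsub hxt)
  exact hx Q hQ t hxQ

lemma mem_intrinsicInterior_of_notMem_intrinsicFrontier {e : Set (Euc d)} {x : Euc d}
    (hx : x ∈ e) (hx' : x ∉ intrinsicFrontier ℝ e) : x ∈ intrinsicInterior ℝ e := by
  rw [← intrinsicClosure_sdiff_intrinsicFrontier]
  exact ⟨subset_intrinsicClosure hx, hx'⟩

end GenericLines

section OutwardNormal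

lemma mem_of_mem_halfBall {E : Type*} [NormedAddCommGroup E] [InnerProductSpace ℝ E] {T : Set E}
    {p m z : E} {r : ℝ} (hfr : ∀ y ∈ Metric.ball p r, inner ℝ m (y - p) ≠ 0 → y ∉ frontier T)
    (hz : z ∈ Metric.ball p r) (hzm : 0 < inner ℝ m (z - p)) (hzT : z ∈ T) {y : E}
    (hy : y ∈ Metric.ball p r) (hym : 0 < inner ℝ m (y - p)) : y ∈ T := by
  have hconvex : Convex ℝ (Metric.ball p r ∩ {y | 0 < inner ℝ m (y - p)}) := by
    simp only [inner_sub_right, sub_pos]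
    exact (convex_ball p r).inter (convex_halfSpace_gt (innerSL ℝ m).isLinear _)
  exact subset_of_disjoint_frontier hconvex.isPreconnected
    (Set.disjoint_left.2 fun w hw => hfr w hw.1 (ne_of_gt hw.2)) ⟨z, ⟨hz, hzm⟩, hzT⟩ ⟨hy, hym⟩

variable {d : ℕ} {T e : Set (Euc d)} {n : Euc d}

lemma IsOutwardNormal.subset_hyperplane {p : Euc d} (hn : IsOutwardNormal T e n) (hp : p ∈ e) :
    e ⊆ hyperplane p n :=
  fun x hx => hn.2.1 p hp x hx

lemma IsOutwardNormal.ne_zero (hn : IsOutwardNormal T e n) : n ≠ 0 :=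
  norm_ne_zero_iff.1 (hn.1.trans_ne one_ne_zero)

lemma IsOutwardNormal.eventually_mem_iff_inner_neg {p : Euc d} (hn : IsOutwardNormal T e n)
    (hp : p ∈ intrinsicInterior ℝ e) {U : Set (Euc d)} (hU : U ∈ 𝓝 p) (hfr : U ∩ frontier T ⊆ e) :
    ∀ᶠ y in 𝓝 p, inner ℝ n (y - p) ≠ 0 → (y ∈ T ↔ inner ℝ n (y - p) < 0) := by
  obtain ⟨r, hr, hrU⟩ := Metric.mem_nhds_iff.1 hU
  obtain ⟨δ, hδ, hδT⟩ := hn.2.2 p hp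
  obtain ⟨s, hs, hsmin⟩ := exists_between (lt_min hδ hr)
  have hfr' : ∀ y ∈ Metric.ball p r, inner ℝ n (y - p) ≠ 0 → y ∉ frontier T := fun y hy hne hyT =>
    hne (hn.2.1 p (intrinsicInterior_subset hp) y (hfr ⟨hrU hy, hyT⟩))
  obtain ⟨hinside, houtside⟩ := hδT s hs (hsmin.trans_le (min_le_left _ _))
  have hdist : ‖s • n‖ < r := by
    rw [norm_smul, hn.1, Real.norm_of_nonneg hs.le, mul_one]
    exact hsmin.trans_le (min_le_right _ _)
  have hinner : inner ℝ n (s • n) = s := by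
    rw [inner_smul_right, real_inner_self_eq_norm_sq, hn.1, one_pow, mul_one]
  filter_upwards [Metric.ball_mem_nhds p hr] with y hy hne
  refine ⟨fun hyT => hne.lt_or_gt.resolve_right fun hpos => ?_, fun hneg => ?_⟩
  · have hyTc : y ∈ Tᶜ := mem_of_mem_halfBall (m := n) (z := p + s • n)
      (by simpa only [frontier_compl] using hfr') (by simpa using hdist)
      (by simpa [hinner] using hs) houtside hy hpos
    exact hyTc hyT
  · exact mem_of_mem_halfBall (m := -n) (z := p - s • n)
      (by simpa only [inner_neg_left, ne_eq, neg_eq_zero] using hfr')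
      (by simpa [Metric.mem_ball, dist_eq_norm] using hdist) (by simpa [hinner] using hs) hinside hy
      (by simpa using hneg)

end OutwardNormal

section Divergence

variable {d : ℕ}

/-- `T` is compact and its boundary is the union of the flat polytopes `e ∈ S`, which do not overlap
and have the outward unit normals `N e`. In contrast to a simplex, `T` need not be convex. -/
structure IsFlatSided (T : Set (Euc d)) (S : Finset (Set (Euc d)))
    (N : Set (Euc d) → Euc d) : Prop where
  compact : IsCompact T
  frontier_eq : frontier T = ⋃ e ∈ S, e
  polytope : ∀ e ∈ S, IsPolytope (d - 1) e
  disjoint : ∀ e ∈ S, ∀ e' ∈ S, e ≠ e' →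
    Disjoint (intrinsicInterior ℝ e) (intrinsicInterior ℝ e')
  normal : ∀ e ∈ S, IsOutwardNormal T e (N e)

/-- Each `e ∈ S` that meets the line through `x` in the direction `v` does so transversally, at a
point of its relative interior. -/
def IsTransversalLine (S : Finset (Set (Euc d))) (N : Set (Euc d) → Euc d) (v x : Euc d) : Prop :=
  ∀ e ∈ S, ∀ t : ℝ, x + t • v ∈ e →
    inner ℝ (N e) v ≠ 0 ∧ x + t • v ∈ intrinsicInterior ℝ e

/-- The difference between the indicator function of `T` and the sum of the indicator functions of
the shadows of the sides `e ∈ S`, with sign `+` for the sides through which a motion in the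
direction `v` leaves `T` and `-` for those through which it enters `T`. -/
def shadowDefect (T : Set (Euc d)) (S : Finset (Set (Euc d))) (N : Set (Euc d) → Euc d)
    (v y : Euc d) : ℝ :=
  T.indicator (1 : Euc d → ℝ) y -
    ∑ e ∈ S, (SignType.sign (inner ℝ (N e) v) : ℝ) * (shadow v e).indicator (1 : Euc d → ℝ) y

variable {T : Set (Euc d)} {S : Finset (Set (Euc d))} {N : Set (Euc d) → Euc d}

lemma IsFlatSided.subset (h : IsFlatSided T S N) {e : Set (Euc d)} (he : e ∈ S) : e ⊆ T :=
  (Set.subset_biUnion_of_mem (u := fun e => e) he).trans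
    (h.frontier_eq ▸ h.compact.isClosed.frontier_subset)

lemma IsFlatSided.isClosed_side (h : IsFlatSided T S N) {e : Set (Euc d)} (he : e ∈ S) :
    IsClosed e :=
  (h.polytope e he).compact.isClosed

lemma IsFlatSided.exists_subset_hyperplane (h : IsFlatSided T S N) {e : Set (Euc d)} (he : e ∈ S) :
    ∃ p, e ⊆ hyperplane p (N e) := by
  obtain ⟨p, hp⟩ := (h.polytope e he).nonempty
  exact ⟨p, (h.normal e he).subset_hyperplane hp⟩

lemma IsFlatSided.ae_isTransversalLine (h : IsFlatSided T S N) (v : Euc d) :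
    ∀ᵐ x : Euc d, x ∉ frontier T ∧ IsTransversalLine S N v x := by
  have hside : ∀ᵐ x : Euc d, ∀ e ∈ S, x ∉ e ∧ ∀ t : ℝ, x + t • v ∈ e →
      inner ℝ (N e) v ≠ 0 ∧ x + t • v ∈ intrinsicInterior ℝ e := by
    rw [Finset.eventually_all]
    intro e he
    obtain ⟨p, hsub⟩ := h.exists_subset_hyperplane he
    have hplane : ∀ᵐ x : Euc d, x ∉ hyperplane p (N e) :=
      measure_eq_zero_iff_ae_notMem.1 (volume_hyperplane p (h.normal e he).ne_zero)
    filter_upwards [hplane, (h.polytope e he).ae_line_notMem_intrinsicFrontier v] with x hx hx'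
    refine ⟨fun hxe => hx (hsub hxe), fun t ht => ⟨fun hparallel => hx ?_,
      mem_intrinsicInterior_of_notMem_intrinsicFrontier ht (hx' t)⟩⟩
    have hxt : inner ℝ (N e) (x + t • v - p) = 0 := hsub ht
    rwa [add_sub_right_comm, inner_add_right, inner_smul_right, hparallel, mul_zero,
      add_zero] at hxt
  filter_upwards [hside] with x hx
  refine ⟨?_, fun e he => (hx e he).2⟩
  simp only [h.frontier_eq, Set.mem_iUnion, not_exists]
  exact fun e he => (hx e he).1

lemma eventually_sum_shadow_eq {S' : Finset (Set (Euc d))} (hclosed : ∀ e ∈ S', IsClosed e)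
    (w : Set (Euc d) → ℝ) {v x : Euc d} {t : ℝ} (ht : ∀ e ∈ S', x + t • v ∉ e) :
    ∀ᶠ s in 𝓝 t, ∑ e ∈ S', w e * (shadow v e).indicator 1 (x + s • v) =
      ∑ e ∈ S', w e * (shadow v e).indicator 1 (x + t • v) := by
  have hall : ∀ᶠ s in 𝓝 t, ∀ e ∈ S', (x + s • v ∈ shadow v e ↔ x + t • v ∈ shadow v e) :=
    (Finset.eventually_all S').2 fun e he => eventually_mem_shadow_iff (hclosed e he) (ht e he)
  filter_upwards [hall] with s hs
  refine Finset.sum_congr rfl fun e he => ?_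
  classical
  simp only [Set.indicator_apply, Pi.one_apply, hs e he]

lemma IsFlatSided.eventually_shadowDefect_eq (h : IsFlatSided T S N) {v x : Euc d} {t : ℝ}
    (ht : x + t • v ∉ frontier T) :
    ∀ᶠ s in 𝓝 t, shadowDefect T S N v (x + s • v) = shadowDefect T S N v (x + t • v) := by
  have hcont : Continuous fun s : ℝ => x + s • v := by fun_prop
  have hsides : ∀ e ∈ S, x + t • v ∉ e := fun e he hte =>
    ht (h.frontier_eq ▸ Set.mem_biUnion (t := fun e => e) he hte)
  filter_upwards [hcont.continuousAt.eventually (eventually_mem_iff_of_notMem_frontier ht),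
    eventually_sum_shadow_eq (fun e he => h.isClosed_side he)
      (fun e => SignType.sign (inner ℝ (N e) v)) hsides] with s hsT hsS
  have hsT' : T.indicator (1 : Euc d → ℝ) (x + s • v) = T.indicator 1 (x + t • v) := by
    by_cases hxT : x + t • v ∈ T <;> simp [hxT, hsT]
  rw [shadowDefect, shadowDefect, hsS, hsT']

lemma IsFlatSided.eventually_shadowDefect_eq_zero (h : IsFlatSided T S N) {v : Euc d} (hv : v ≠ 0)
    (x : Euc d) : ∀ᶠ s : ℝ in atTop, shadowDefect T S N v (x + s • v) = 0 := by
  have hline : IsClosedEmbedding (fun s : ℝ => x + s • v) :=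
    (Homeomorph.addLeft x).isClosedEmbedding.comp (isClosedEmbedding_smul_left hv)
  obtain ⟨R, hR⟩ := (hline.isCompact_preimage h.compact).bddAbove
  filter_upwards [eventually_gt_atTop R] with s hs
  have houtside {u : ℝ} (hu : s ≤ u) : x + u • v ∉ T := fun hm => (hs.trans_le hu).not_ge (hR hm)
  rw [shadowDefect, Set.indicator_of_notMem (houtside le_rfl), Finset.sum_eq_zero, sub_zero]
  intro e he
  rw [Set.indicator_of_notMem, mul_zero]
  intro hmem
  obtain ⟨u, hu, hue⟩ := add_smul_mem_shadow_iff.1 hmem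
  exact houtside hu.le (h.subset he hue)

lemma IsFlatSided.eventually_mem_iff_at_crossing (h : IsFlatSided T S N) {v x : Euc d} {t : ℝ}
    {e : Set (Euc d)} (he : e ∈ S) (hv : inner ℝ (N e) v ≠ 0)
    (hint : x + t • v ∈ intrinsicInterior ℝ e)
    (hother : ∀ e' ∈ S, e' ≠ e → x + t • v ∉ e') :
    ∀ᶠ s in 𝓝[≠] t, (x + s • v ∈ T ↔ (s - t) * inner ℝ (N e) v < 0) := by
  classical
  have hcont : Continuous fun s : ℝ => x + s • v := by fun_prop
  have hU : (⋃ e' ∈ S.erase e, e')ᶜ ∈ 𝓝 (x + t • v) := by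
    refine (isClosed_biUnion_finset fun e' he' =>
      h.isClosed_side (Finset.mem_of_mem_erase he')).isOpen_compl.mem_nhds ?_
    simp only [Set.mem_compl_iff, Set.mem_iUnion, not_exists]
    exact fun e' he' => hother e' (Finset.mem_of_mem_erase he') (Finset.ne_of_mem_erase he')
  have hfr : (⋃ e' ∈ S.erase e, e')ᶜ ∩ frontier T ⊆ e := by
    rintro y ⟨hyU, hyT⟩
    rw [h.frontier_eq] at hyT
    obtain ⟨e', he', hye'⟩ := Set.mem_iUnion₂.1 hyT
    by_contra hye
    have hne : e' ≠ e := fun heq => hye (heq ▸ hye')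
    exact hyU (Set.mem_biUnion (t := fun e => e) (Finset.mem_erase.2 ⟨hne, he'⟩) hye')
  rw [eventually_nhdsWithin_iff]
  filter_upwards [hcont.continuousAt.eventually
    ((h.normal e he).eventually_mem_iff_inner_neg hint hU hfr)] with s hs hst
  rw [add_sub_add_left_eq_sub, ← sub_smul, inner_smul_right] at hs
  exact hs (mul_ne_zero (sub_ne_zero.2 hst) hv)

lemma IsFlatSided.exists_shadowDefect_eq_at_crossing (h : IsFlatSided T S N) {v x : Euc d}
    (hline : IsTransversalLine S N v x) {t : ℝ} {e : Set (Euc d)} (he : e ∈ S)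
    (hte : x + t • v ∈ e) : ∃ c, ∀ᶠ s in 𝓝[≠] t, shadowDefect T S N v (x + s • v) = c := by
  classical
  obtain ⟨hv, hint⟩ := hline e he t hte
  have hother : ∀ e' ∈ S, e' ≠ e → x + t • v ∉ e' := fun e' he' hne hte' =>
    Set.disjoint_left.1 (h.disjoint e' he' e he hne) (hline e' he' t hte').2 hint
  have hrest := eventually_sum_shadow_eq
    (fun e' he' => h.isClosed_side (Finset.mem_of_mem_erase (a := e) he'))
    (fun e' => SignType.sign (inner ℝ (N e') v))
    (fun e' he' => hother e' (Finset.mem_of_mem_erase he') (Finset.ne_of_mem_erase he'))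
  refine ⟨(if 0 < inner ℝ (N e) v then 0 else 1) - ∑ e' ∈ S.erase e,
    (SignType.sign (inner ℝ (N e') v) : ℝ) * (shadow v e').indicator 1 (x + t • v), ?_⟩
  filter_upwards [h.eventually_mem_iff_at_crossing he hv hint hother,
    eventually_nhdsWithin_of_eventually_nhds hrest, self_mem_nhdsWithin] with s hsT hsS hst
  have hshadow := add_smul_mem_shadow_iff_lt (h.normal e he).2.1 hv hte s
  have hjump : T.indicator (1 : Euc d → ℝ) (x + s • v) -
      SignType.sign (inner ℝ (N e) v) * (shadow v e).indicator 1 (x + s • v) =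
        if 0 < inner ℝ (N e) v then 0 else 1 := by
    simp only [Set.indicator_apply, hsT, hshadow, Pi.one_apply]
    rcases lt_or_gt_of_ne hv with hneg | hpos <;> rcases lt_or_gt_of_ne hst with hlt | hgt
    · simp [(mul_pos_of_neg_of_neg (sub_neg.2 hlt) hneg).not_gt, hlt, hneg, hneg.not_gt]
    · simp [mul_neg_of_pos_of_neg (sub_pos.2 hgt) hneg, hgt.not_gt, hneg.not_gt]
    · simp [mul_neg_of_neg_of_pos (sub_neg.2 hlt) hpos, hlt, hpos]
    · simp [(mul_pos (sub_pos.2 hgt) hpos).not_gt, hgt.not_gt, hpos]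
  rw [shadowDefect, ← Finset.add_sum_erase S _ he, hsS, ← sub_sub, hjump]

lemma IsFlatSided.indicator_eq_sum_shadow (h : IsFlatSided T S N) {v : Euc d} (hv : v ≠ 0)
    {x : Euc d} (hx : x ∉ frontier T) (hline : IsTransversalLine S N v x) :
    T.indicator (1 : Euc d → ℝ) x =
      ∑ e ∈ S, (SignType.sign (inner ℝ (N e) v) : ℝ) * (shadow v e).indicator 1 x := by
  have hzero := eq_zero_of_eventually_const (D := fun t => shadowDefect T S N v (x + t • v))
    (t₀ := 0) (fun t => ?_) (h.eventually_shadowDefect_eq_zero hv x)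
    (h.eventually_shadowDefect_eq (by simpa using hx))
  · simpa [shadowDefect, sub_eq_zero] using hzero
  · by_cases ht : x + t • v ∈ frontier T
    · obtain ⟨e, he, hte⟩ := Set.mem_iUnion₂.1 (h.frontier_eq ▸ ht)
      exact h.exists_shadowDefect_eq_at_crossing hline he hte
    · exact ⟨_, eventually_nhdsWithin_of_eventually_nhds (h.eventually_shadowDefect_eq ht)⟩

lemma IsFlatSided.integral_fderiv_of_hasCompactSupport (h : IsFlatSided T S N) (v : Euc d)
    {f : Euc d → ℝ} (hf : ContDiff ℝ 1 f) (hf' : HasCompactSupport f) :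
    ∫ x in T, fderiv ℝ f x v = ∑ e ∈ S, inner ℝ (N e) v * ∫ x in e, f x ∂(surf d) := by
  rcases eq_or_ne v 0 with rfl | hv
  · simp
  let g : Euc d → ℝ := fun x => fderiv ℝ f x v
  have hside {e : Set (Euc d)} (he : e ∈ S) (hc : inner ℝ (N e) v ≠ 0) :
      MeasurableSet (shadow v e) ∧
        ∫ x in shadow v e, g x = |inner ℝ (N e) v| * ∫ x in e, f x ∂(surf d) := by
    obtain ⟨p, hsub⟩ := h.exists_subset_hyperplane he
    have hm := (h.isClosed_side he).measurableSet
    exact ⟨measurableSet_shadow hc hsub hm,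
      area_eq_surf d ▸ setIntegral_shadow_fderiv (h.normal e he).1 hc hsub hm hf hf'⟩
  have hae : T.indicator g =ᵐ[volume] fun x => ∑ e ∈ S, SignType.sign (inner ℝ (N e) v) *
      (shadow v e).indicator g x := by
    filter_upwards [h.ae_isTransversalLine v] with x hx
    have hmul (s : Set (Euc d)) : s.indicator g x = s.indicator 1 x * g x := by
      by_cases hs : x ∈ s <;> simp [hs]
    simp only [hmul, h.indicator_eq_sum_shadow hv hx.1 hx.2, Finset.sum_mul, mul_assoc]
  rw [← integral_indicator h.compact.measurableSet, integral_congr_ae hae, integral_finsetSum]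
  · refine Finset.sum_congr rfl fun e he => ?_
    by_cases hc : inner ℝ (N e) v = 0
    · simp [hc]
    · rw [integral_const_mul, integral_indicator (hside he hc).1, (hside he hc).2, ← mul_assoc,
        sign_mul_abs]
  · intro e he
    by_cases hc : inner ℝ (N e) v = 0
    · simp [hc]
    · exact ((integrable_fderiv_apply hf hf' v).indicator (hside he hc).1).const_mul _

theorem IsFlatSided.integral_fderiv (h : IsFlatSided T S N) (v : Euc d) {f : Euc d → ℝ}
    (hf : ContDiff ℝ 1 f) :
    ∫ x in T, fderiv ℝ f x v = ∑ e ∈ S, inner ℝ (N e) v * ∫ x in e, f x ∂(surf d) := by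
  obtain ⟨R, hR0, hR⟩ := h.compact.isBounded.subset_ball_lt 0 (0 : Euc d)
  let χ : ContDiffBump (0 : Euc d) := ⟨R, R + 1, hR0, lt_add_one R⟩
  have hχ (x : Euc d) (hx : x ∈ T) : (fun x => χ x * f x) =ᶠ[𝓝 x] f := by
    filter_upwards [Metric.isOpen_ball.mem_nhds (hR hx)] with y hy
    rw [χ.one_of_mem_closedBall (Metric.ball_subset_closedBall hy), one_mul]
  have hcutoff := h.integral_fderiv_of_hasCompactSupport v (f := fun x => χ x * f x)
    (χ.contDiff.mul hf) χ.hasCompactSupport.mul_right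
  rw [setIntegral_congr_fun (g := fun x => fderiv ℝ f x v) h.compact.measurableSet fun x hx =>
    by simp only [(hχ x hx).fderiv_eq]] at hcutoff
  rw [hcutoff]
  refine Finset.sum_congr rfl fun e he => congrArg _ ?_
  exact setIntegral_congr_fun (h.isClosed_side he).measurableSet fun x hx =>
    (hχ x (h.subset he hx)).eq_of_nhds

end Divergence

section SquareIntegrable

lemma exists_inner_eq_of_ker_le_ker {W H : Type*} [AddCommGroup W] [Module ℝ W]
    [FiniteDimensional ℝ W] [NormedAddCommGroup H] [InnerProductSpace ℝ H]
    (J : W →ₗ[ℝ] H) (L : W →ₗ[ℝ] ℝ) (hL : LinearMap.ker J ≤ LinearMap.ker L) :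
    ∃ g, ∀ w, inner ℝ (J g) (J w) = L w := by
  obtain ⟨ℓ, rfl⟩ : L ∈ LinearMap.range J.rangeRestrict.dualMap := by
    rw [LinearMap.range_dualMap_eq_dualAnnihilator_ker, LinearMap.ker_rangeRestrict,
      Submodule.mem_dualAnnihilator]
    exact fun w hw => hL hw
  obtain ⟨⟨_, g, rfl⟩, hg⟩ :=
    (InnerProductSpace.toDual ℝ (LinearMap.range J)).surjective (LinearMap.toContinuousLinearMap ℓ)
  exact ⟨g, fun w => congrArg (fun f => f (J.rangeRestrict w)) hg⟩

variable {X F : Type*} [MeasurableSpace X] {ν : Measure X} [NormedAddCommGroup F] {f g : X → F}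

lemma integral_sum_sum {ι κ : Type*} [Fintype ι] [Fintype κ] {h : ι → κ → X → ℝ}
    (hh : ∀ i j, Integrable (h i j) ν) :
    ∫ x, ∑ i, ∑ j, h i j x ∂ν = ∑ i, ∑ j, ∫ x, h i j x ∂ν := by
  rw [integral_finsetSum _ fun i _ => integrable_finsetSum _ fun j _ => hh i j]
  exact Finset.sum_congr rfl fun i _ => integral_finsetSum _ fun j _ => hh i j

lemma memLp_restrict_of_isCompact {p : ENNReal} [TopologicalSpace X] [OpensMeasurableSpace X]
    [T2Space X] [SecondCountableTopologyEither X F] {K : Set X} (hK : IsCompact K) (hν : ν K < ⊤)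
    (hf : ContinuousOn f K) : MemLp f p (ν.restrict K) := by
  have : IsFiniteMeasure (ν.restrict K) := ⟨by simpa using hν⟩
  obtain ⟨C, hC⟩ := hK.exists_bound_of_continuousOn hf
  exact MemLp.of_bound (hf.aestronglyMeasurable hK.measurableSet) C
    ((ae_restrict_iff' hK.measurableSet).2 (Eventually.of_forall hC))

variable [InnerProductSpace ℝ F]

lemma inner_toLp (hf : MemLp f 2 ν) (hg : MemLp g 2 ν) :
    inner ℝ (hf.toLp f) (hg.toLp g) = ∫ x, inner ℝ (f x) (g x) ∂ν := by
  rw [L2.inner_def]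
  refine integral_congr_ae ?_
  filter_upwards [hf.coeFn_toLp, hg.coeFn_toLp] with x hfx hgx
  rw [hfx, hgx]

lemma integrable_inner (hf : MemLp f 2 ν) (hg : MemLp g 2 ν) :
    Integrable (fun x => inner ℝ (f x) (g x)) ν := by
  refine (L2.integrable_inner (𝕜 := ℝ) (hf.toLp f) (hg.toLp g)).congr ?_
  filter_upwards [hf.coeFn_toLp, hg.coeFn_toLp] with x hfx hgx
  rw [hfx, hgx]

lemma sq_integral_inner_le (hf : MemLp f 2 ν) (hg : MemLp g 2 ν) :
    (∫ x, inner ℝ (f x) (g x) ∂ν) ^ 2 ≤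
      (∫ x, inner ℝ (f x) (f x) ∂ν) * ∫ x, inner ℝ (g x) (g x) ∂ν := by
  rw [← inner_toLp hf hg, ← inner_toLp hf hf, ← inner_toLp hg hg, sq]
  exact real_inner_mul_inner_self_le _ _

lemma integral_inner_sub_left {f' : X → F} (hf : MemLp f 2 ν) (hf' : MemLp f' 2 ν)
    (hg : MemLp g 2 ν) :
    ∫ x, inner ℝ ((f - f') x) (g x) ∂ν =
      ∫ x, inner ℝ (f x) (g x) ∂ν - ∫ x, inner ℝ (f' x) (g x) ∂ν := by
  simp only [Pi.sub_apply, inner_sub_left]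
  exact integral_sub (integrable_inner hf hg) (integrable_inner hf' hg)

/-- The map that sends a parameter `w` to the `L²` class of the function `S w`, for a linear family
`S` of square integrable functions. -/
def toL2 {W : Type*} [AddCommGroup W] [Module ℝ W] (S : W →ₗ[ℝ] X → F)
    (hS : ∀ w, MemLp (S w) 2 ν) : W →ₗ[ℝ] Lp F 2 ν where
  toFun w := (hS w).toLp (S w)
  map_add' w z := by
    rw [← MemLp.toLp_add]
    simp only [map_add]
  map_smul' a w := by
    rw [RingHom.id_apply, ← MemLp.toLp_const_smul]
    simp only [map_smul]

lemma exists_integral_inner_eq {W Y F' : Type*} [AddCommGroup W] [Module ℝ W]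
    [FiniteDimensional ℝ W] [MeasurableSpace Y] {ν' : Measure Y} [NormedAddCommGroup F']
    [InnerProductSpace ℝ F'] {S : W →ₗ[ℝ] X → F} {S' : W →ₗ[ℝ] Y → F'}
    (hS : ∀ w, MemLp (S w) 2 ν) (hS' : ∀ w, MemLp (S' w) 2 ν') {c : ℝ}
    (hle : ∀ w, ∫ y, inner ℝ (S' w y) (S' w y) ∂ν' ≤ c * ∫ x, inner ℝ (S w x) (S w x) ∂ν)
    {h : Y → F'} (hh : MemLp h 2 ν') :
    ∃ g, ∀ w, ∫ x, inner ℝ (S g x) (S w x) ∂ν = ∫ y, inner ℝ (h y) (S' w y) ∂ν' := by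
  have hker : LinearMap.ker (toL2 S hS) ≤ LinearMap.ker (toL2 S' hS') := fun w hw => by
    have hzero : ∫ x, inner ℝ (S w x) (S w x) ∂ν = 0 := by
      rw [← inner_toLp (hS w) (hS w)]
      exact inner_self_eq_zero.2 hw
    have hnonpos := hle w
    rw [hzero, mul_zero, ← inner_toLp (hS' w) (hS' w)] at hnonpos
    exact real_inner_self_nonpos.1 hnonpos
  obtain ⟨g, hg⟩ := exists_inner_eq_of_ker_le_ker (toL2 S hS)
    (innerₛₗ ℝ (hh.toLp h) ∘ₗ toL2 S' hS') (hker.trans (LinearMap.ker_le_ker_comp _ _))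
  refine ⟨g, fun w => ?_⟩
  rw [← inner_toLp (hS g) (hS w), ← inner_toLp hh (hS' w)]
  exact hg w

end SquareIntegrable

section TraceInequality

lemma exists_sq_eval_one_le (m r : ℕ) : ∃ C : ℝ, 0 ≤ C ∧ ∀ q : Polynomial ℝ, q.natDegree ≤ r →
    q.eval 1 ^ 2 ≤ C * ∫ t in Set.Ioo (0 : ℝ) 1, t ^ m * q.eval t ^ 2 := by
  let W := Polynomial.degreeLT ℝ (r + 1)
  have : FiniteDimensional ℝ W := Module.Finite.equiv (Polynomial.degreeLTEquiv ℝ (r + 1)).symm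
  -- The weight in the norm of `toL2 S hS` is `t ^ (2 * m)`, at most `t ^ m` on the unit interval.
  let S : W →ₗ[ℝ] ℝ → ℝ := LinearMap.pi fun t => t ^ m • Polynomial.leval t ∘ₗ W.subtype
  have hcont (w : W) : Continuous (S w) := (continuous_pow m).mul w.1.continuous
  have hS (w : W) : MemLp (S w) 2 (volume.restrict (Set.Icc (0 : ℝ) 1)) :=
    memLp_restrict_of_isCompact isCompact_Icc isCompact_Icc.measure_lt_top (hcont w).continuousOn
  obtain ⟨g, hg⟩ := exists_inner_eq_of_ker_le_ker (toL2 S hS)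
    (Polynomial.leval 1 ∘ₗ W.subtype) fun w hw => by
      have hae : S w =ᵐ[volume.restrict (Set.Icc (0 : ℝ) 1)] 0 :=
        (hS w).coeFn_toLp.symm.trans ((Lp.eq_zero_iff_ae_eq_zero).1 (LinearMap.mem_ker.1 hw))
      have hone := Measure.eqOn_Icc_of_ae_eq volume zero_ne_one hae (hcont w).continuousOn
        continuousOn_const (Set.right_mem_Icc.2 zero_le_one)
      simpa [S] using hone
  refine ⟨inner ℝ (toL2 S hS g) (toL2 S hS g), real_inner_self_nonneg, fun q hq => ?_⟩
  let w : W := ⟨q, Polynomial.mem_degreeLT.2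
    (q.degree_le_natDegree.trans_lt (by exact_mod_cast Nat.lt_succ_of_le hq))⟩
  have hqw : inner ℝ (toL2 S hS w) (toL2 S hS w) ≤
      ∫ t in Set.Ioo (0 : ℝ) 1, t ^ m * q.eval t ^ 2 := by
    rw [← integral_Icc_eq_integral_Ioo, toL2, LinearMap.coe_mk, AddHom.coe_mk, inner_toLp]
    refine setIntegral_mono_on (integrable_inner (hS w) (hS w))
      (Continuous.integrableOn_Icc (by fun_prop)) measurableSet_Icc fun t ht => ?_
    calc inner ℝ (S w t) (S w t) = t ^ m * (t ^ m * q.eval t ^ 2) := by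
          change t ^ m * q.eval t * (t ^ m * q.eval t) = _
          ring
      _ ≤ t ^ m * q.eval t ^ 2 := mul_le_of_le_one_left
          (mul_nonneg (pow_nonneg ht.1 m) (sq_nonneg _)) (pow_le_one₀ ht.1 ht.2)
  calc q.eval 1 ^ 2 = inner ℝ (toL2 S hS g) (toL2 S hS w) ^ 2 := by rw [hg]; rfl
    _ ≤ inner ℝ (toL2 S hS g) (toL2 S hS g) * inner ℝ (toL2 S hS w) (toL2 S hS w) := by
        rw [sq]; exact real_inner_mul_inner_self_le _ _
    _ ≤ _ := mul_le_mul_of_nonneg_left hqw real_inner_self_nonneg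

end TraceInequality

section Polynomials

lemma totalDegree_pderiv_le {σ R : Type*} [CommSemiring R] (j : σ) (p : MvPolynomial σ R) :
    (MvPolynomial.pderiv j p).totalDegree ≤ p.totalDegree - 1 := by
  conv_lhs => rw [p.as_sum, map_sum]
  refine MvPolynomial.totalDegree_finsetSum_le fun m hm => ?_
  rw [MvPolynomial.pderiv_monomial]
  by_cases hj : m j = 0
  · simp [hj]
  have hm_le : m.degree ≤ p.totalDegree := MvPolynomial.le_totalDegree hm
  have hdeg : (m - Finsupp.single j 1).degree + 1 = m.degree := by
    conv_rhs =>
      rw [← tsub_add_cancel_of_le (Finsupp.single_le_iff.2 (Nat.one_le_iff_ne_zero.2 hj)),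
        map_add, Finsupp.degree_single]
  calc _ ≤ (m - Finsupp.single j 1).degree := MvPolynomial.totalDegree_monomial_le _ _
    _ ≤ p.totalDegree - 1 := by omega

variable {d r s : ℕ} {f g : Euc d → ℝ}

lemma isPoly_const (r : ℕ) (a : ℝ) : IsPoly r (fun _ : Euc d => a) :=
  ⟨MvPolynomial.C a, by simp, by simp⟩

lemma IsPoly.mono (hf : IsPoly r f) (h : r ≤ s) : IsPoly s f := by
  obtain ⟨p, hp, hpf⟩ := hf
  exact ⟨p, hp.trans h, hpf⟩

/-- The space of polynomials of degree at most `r`. -/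
def polySpace (d r : ℕ) : Submodule ℝ (Euc d → ℝ) where
  carrier := {f | IsPoly r f}
  add_mem' := by
    rintro f g ⟨p, hp, hpf⟩ ⟨q, hq, hqg⟩
    exact ⟨p + q, (MvPolynomial.totalDegree_add p q).trans (max_le hp hq),
      fun x => by simp only [Pi.add_apply, hpf, hqg, map_add]⟩
  zero_mem' := isPoly_const r 0
  smul_mem' := by
    rintro a f ⟨p, hp, hpf⟩
    exact ⟨a • p, (MvPolynomial.totalDegree_smul_le a p).trans hp,
      fun x => by simp only [Pi.smul_apply, hpf, MvPolynomial.smul_eval, smul_eq_mul]⟩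

instance (d r : ℕ) : FiniteDimensional ℝ (polySpace d r) := by
  let φ : MvPolynomial.restrictTotalDegree (Fin d) ℝ r →ₗ[ℝ] polySpace d r :=
    { toFun := fun p => ⟨fun x => MvPolynomial.eval (fun i => x i) p.1, p.1,
        (MvPolynomial.mem_restrictTotalDegree _ _ _).1 p.2, fun _ => rfl⟩
      map_add' := fun p q => by ext x; simp
      map_smul' := fun a p => by ext x; simp [MvPolynomial.smul_eval] }
  refine Module.Finite.of_surjective φ ?_
  rintro ⟨f, p, hp, hpf⟩
  exact ⟨⟨p, (MvPolynomial.mem_restrictTotalDegree _ _ _).2 hp⟩, by ext x; exact (hpf x).symm⟩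

lemma IsPoly.contDiff (hf : IsPoly r f) : ContDiff ℝ 1 f := by
  obtain ⟨p, -, hpf⟩ := hf
  rw [show f = _ from funext hpf]
  exact (AnalyticOnNhd.eval_continuousLinearMap'
    (fun i => (EuclideanSpace.proj i : Euc d →L[ℝ] ℝ)) p).contDiff

lemma IsPoly.continuous (hf : IsPoly r f) : Continuous f := hf.contDiff.continuous

lemma IsPoly.differentiable (hf : IsPoly r f) : Differentiable ℝ f :=
  hf.contDiff.differentiable one_ne_zero

lemma pd_eval (j : Fin d) (p : MvPolynomial (Fin d) ℝ) (x : Euc d) :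
    pd j (fun y : Euc d => MvPolynomial.eval (fun i => y i) p) x =
      MvPolynomial.eval (fun i => x i) (MvPolynomial.pderiv j p) := by
  have hdiff (q : MvPolynomial (Fin d) ℝ) :
      Differentiable ℝ (fun y : Euc d => MvPolynomial.eval (fun i => y i) q) :=
    IsPoly.differentiable ⟨q, le_rfl, fun _ => rfl⟩
  induction p using MvPolynomial.induction_on with
  | C a => simp [pd]
  | add p q hp hq =>
    simp only [pd, map_add] at hp hq ⊢
    rw [fderiv_fun_add (hdiff p x) (hdiff q x), add_apply, hp, hq]
  | mul_X p i hp =>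
    simp only [pd, map_mul, MvPolynomial.eval_X, Derivation.leibniz, smul_eq_mul, map_add,
      MvPolynomial.pderiv_X] at hp ⊢
    have hproj : HasFDerivAt (fun y : Euc d => y i) (EuclideanSpace.proj i : Euc d →L[ℝ] ℝ) x :=
      (EuclideanSpace.proj i : Euc d →L[ℝ] ℝ).hasFDerivAt
    rw [fderiv_fun_mul (hdiff p x) hproj.differentiableAt, hproj.fderiv]
    simp only [add_apply, smul_apply, smul_eq_mul, hp, Pi.single_apply]
    by_cases hij : i = j
    · subst hij; simp
    · simp [hij]

lemma IsPoly.pd (hf : IsPoly r f) (j : Fin d) : IsPoly (r - 1) (pd j f) := by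
  obtain ⟨p, hp, hpf⟩ := hf
  refine ⟨MvPolynomial.pderiv j p, (totalDegree_pderiv_le j p).trans (by omega), fun x => ?_⟩
  rw [← pd_eval, ← show f = _ from funext hpf]

lemma IsPoly.exists_polynomial_lineMap (hf : IsPoly r f) (x y : Euc d) :
    ∃ q : Polynomial ℝ, q.natDegree ≤ r ∧ ∀ t : ℝ, q.eval t = f (AffineMap.lineMap x y t) := by
  obtain ⟨p, hp, hpf⟩ := hf
  refine ⟨MvPolynomial.aeval (fun i => Polynomial.X * Polynomial.C (y i - x i) +
    Polynomial.C (x i)) p, ?_, fun t => ?_⟩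
  · refine (MvPolynomial.aeval_natDegree_le p hp _ (n := 1) fun i => ?_).trans (by simp)
    compute_degree
  · rw [hpf, MvPolynomial.aeval_def, MvPolynomial.polynomial_eval_eval₂, ← MvPolynomial.eval₂_id]
    congr 1
    · ext a; simp
    · ext i; simp [AffineMap.lineMap_apply]

end Polynomials

section TraceBound

variable {d r : ℕ} {T e : Set (Euc d)}

lemma exists_ofReal_sq_le_lintegral_lineMap (d m r : ℕ) :
    ∃ C : ℝ, 0 ≤ C ∧ ∀ f : Euc d → ℝ, IsPoly r f → ∀ x y : Euc d,
      ENNReal.ofReal (f y ^ 2) ≤ ENNReal.ofReal C * ∫⁻ t in Set.Ioo (0 : ℝ) 1,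
        ENNReal.ofReal (t ^ m) * ENNReal.ofReal (f (AffineMap.lineMap x y t) ^ 2) := by
  obtain ⟨C, hC, hCq⟩ := exists_sq_eval_one_le m r
  refine ⟨C, hC, fun f hf x y => ?_⟩
  obtain ⟨q, hq, hqf⟩ := hf.exists_polynomial_lineMap x y
  have hint : IntegrableOn (fun t => t ^ m * q.eval t ^ 2) (Set.Ioo (0 : ℝ) 1) :=
    (Continuous.integrableOn_Icc (by fun_prop)).mono_set Set.Ioo_subset_Icc_self
  have hnonneg : ∀ t ∈ Set.Ioo (0 : ℝ) 1, 0 ≤ t ^ m := fun t ht => pow_nonneg ht.1.le m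
  calc ENNReal.ofReal (f y ^ 2) = ENNReal.ofReal (q.eval 1 ^ 2) := by
        rw [hqf, AffineMap.lineMap_apply_one]
    _ ≤ ENNReal.ofReal (C * ∫ t in Set.Ioo (0 : ℝ) 1, t ^ m * q.eval t ^ 2) :=
        ENNReal.ofReal_le_ofReal (hCq q hq)
    _ = ENNReal.ofReal C *
          ∫⁻ t in Set.Ioo (0 : ℝ) 1, ENNReal.ofReal (t ^ m * q.eval t ^ 2) := by
        rw [ENNReal.ofReal_mul hC, ofReal_integral_eq_lintegral_ofReal hint]
        exact ae_restrict_of_forall_mem measurableSet_Ioo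
          fun t ht => mul_nonneg (hnonneg t ht) (sq_nonneg _)
    _ = _ := by
        congr 1
        refine setLIntegral_congr_fun measurableSet_Ioo fun t ht => ?_
        rw [ENNReal.ofReal_mul (hnonneg t ht), hqf]

/-- The trace inequality with constant `C`, from the element `T` to its side `e`, for polynomials of
degree at most `r`. -/
def TraceBound (r : ℕ) (T e : Set (Euc d)) (C : ℝ) : Prop :=
  ∀ f : Euc d → ℝ, IsPoly r f → ∫ x in e, f x ^ 2 ∂(surf d) ≤ C * ∫ x in T, f x ^ 2

lemma TraceBound.mono {C C' : ℝ} (h : TraceBound r T e C) (hC : C ≤ C') : TraceBound r T e C' :=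
  fun f hf => (h f hf).trans
    (mul_le_mul_of_nonneg_right hC (integral_nonneg fun _ => sq_nonneg _))

lemma exists_traceBound_of_pyramid (d r : ℕ) : ∃ C : ℝ, 0 ≤ C ∧
    ∀ {T e : Set (Euc d)} {n A : Euc d} {H : ℝ}, IsCompact T → IsCompact e → ‖n‖ = 1 → 0 < H →
      (∀ x ∈ e, inner ℝ n (x - A) = H) → convexJoin ℝ {A} e ⊆ T → TraceBound r T e (C / H) := by
  obtain ⟨C, hC, hCf⟩ := exists_ofReal_sq_le_lintegral_lineMap d (d - 1) r
  refine ⟨C, hC, fun {T e n A H} hT he hn hH hbase hpyramid f hf => ?_⟩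
  have hfc := hf.continuous
  have hpyr := lintegral_pyramid_le hn hH hbase he.measurableSet hT.measurableSet hpyramid
    (F := fun x => ENNReal.ofReal (f x ^ 2)) (by fun_prop)
  rw [finrank_euclideanSpace_fin, area_eq_surf] at hpyr
  have hlint : ENNReal.ofReal H * ∫⁻ x in e, ENNReal.ofReal (f x ^ 2) ∂(surf d) ≤
      ENNReal.ofReal C * ∫⁻ x in T, ENNReal.ofReal (f x ^ 2) := by
    refine le_trans ?_ (mul_le_mul_right hpyr _)
    rw [mul_left_comm]
    refine mul_le_mul_right ?_ _
    rw [← lintegral_const_mul' _ _ ENNReal.ofReal_ne_top]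
    exact lintegral_mono fun y => hCf f hf A y
  have hTtop : ∫⁻ x in T, ENNReal.ofReal (f x ^ 2) ≠ ⊤ :=
    ((hfc.pow 2).continuousOn.integrableOn_compact hT).lintegral_lt_top.ne
  have hreal := ENNReal.toReal_mono (ENNReal.mul_ne_top ENNReal.ofReal_ne_top hTtop) hlint
  simp only [ENNReal.toReal_mul, ENNReal.toReal_ofReal hH.le, ENNReal.toReal_ofReal hC] at hreal
  rw [integral_eq_lintegral_of_nonneg_ae (Eventually.of_forall fun x => sq_nonneg _) (by fun_prop),
    integral_eq_lintegral_of_nonneg_ae (Eventually.of_forall fun x => sq_nonneg _) (by fun_prop),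
    div_mul_eq_mul_div, le_div_iff₀ hH, mul_comm]
  exact hreal

end TraceBound

section FieldSpaces

variable {d r : ℕ}

/-- The space `[P_r]^d` of polynomial vector fields. -/
def polyVecSpace (d r : ℕ) : Submodule ℝ (Euc d → Euc d) where
  carrier := {f | IsPolyVec r f}
  add_mem' hf hg i := (polySpace d r).add_mem (hf i) (hg i)
  zero_mem' _ := isPoly_const r 0
  smul_mem' a _ hf i := (polySpace d r).smul_mem a (hf i)

/-- The space `[P_r]^{d × d}` of polynomial matrix fields. -/
def polyMatSpace (d r : ℕ) : Submodule ℝ (Euc d → Matrix (Fin d) (Fin d) ℝ) where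
  carrier := {φ | IsPolyMat r φ}
  add_mem' hφ hψ i j := (polySpace d r).add_mem (hφ i j) (hψ i j)
  zero_mem' _ _ := isPoly_const r 0
  smul_mem' a _ hφ i j := (polySpace d r).smul_mem a (hφ i j)

instance (d r : ℕ) : FiniteDimensional ℝ (polyVecSpace d r) :=
  let entries : polyVecSpace d r →ₗ[ℝ] Fin d → polySpace d r :=
    { toFun := fun f i => ⟨fun x => f.1 x i, f.2 i⟩
      map_add' := fun _ _ => rfl
      map_smul' := fun _ _ => rfl }
  Module.Finite.of_injective entries fun _ _ h => Subtype.ext <| funext fun x => by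
    ext i
    exact congrFun (Subtype.ext_iff.1 (congrFun h i)) x

instance (d r : ℕ) : FiniteDimensional ℝ (polyMatSpace d r) :=
  let entries : polyMatSpace d r →ₗ[ℝ] Fin d → Fin d → polySpace d r :=
    { toFun := fun φ i j => ⟨fun x => φ.1 x i j, φ.2 i j⟩
      map_add' := fun _ _ => rfl
      map_smul' := fun _ _ => rfl }
  Module.Finite.of_injective entries fun _ _ h => Subtype.ext <| funext fun x => by
    ext i j
    exact congrFun (Subtype.ext_iff.1 (congrFun (congrFun h i) j)) x

/-- The space of rigid motions. -/
def rigidMotions (d : ℕ) : Submodule ℝ (Euc d → Euc d) where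
  carrier := {f | IsRigidMotion f}
  add_mem' := by
    rintro f g ⟨a, η, hη, hf⟩ ⟨b, ζ, hζ, hg⟩
    refine ⟨a + b, η + ζ, by rw [Matrix.transpose_add, hη, hζ, neg_add], fun x => ?_⟩
    rw [Pi.add_apply, hf, hg, map_add, LinearMap.add_apply]
    abel
  zero_mem' := ⟨0, 0, by simp, by simp⟩
  smul_mem' := by
    rintro c f ⟨a, η, hη, hf⟩
    refine ⟨c • a, c • η, by rw [Matrix.transpose_smul, hη, smul_neg], fun x => ?_⟩
    rw [Pi.smul_apply, hf, map_smul, LinearMap.smul_apply, smul_add]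

lemma IsRigidMotion.isPolyVec {f : Euc d → Euc d} (hf : IsRigidMotion f) : IsPolyVec 1 f := by
  obtain ⟨a, η, -, hf⟩ := hf
  refine fun i => ⟨MvPolynomial.C (a i) + ∑ j, η i j • MvPolynomial.X j, ?_, fun x => ?_⟩
  · refine (MvPolynomial.totalDegree_add _ _).trans (max_le (by simp) ?_)
    exact MvPolynomial.totalDegree_finsetSum_le fun j _ =>
      (MvPolynomial.totalDegree_smul_le _ _).trans (MvPolynomial.totalDegree_X j).le
  · simp [hf, Matrix.toLpLin_apply, Matrix.mulVec, dotProduct, MvPolynomial.smul_eval]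

lemma polyVecSpace_sup_rigidMotions_le :
    polyVecSpace d r ⊔ rigidMotions d ≤ polyVecSpace d (max r 1) :=
  sup_le (fun _ hf i => (hf i).mono (le_max_left _ _))
    fun _ hf i => (hf.isPolyVec i).mono (le_max_right _ _)

instance : FiniteDimensional ℝ ↥(polyVecSpace d r ⊔ rigidMotions d) :=
  Submodule.finiteDimensional_of_le polyVecSpace_sup_rigidMotions_le

lemma inSideSpace_iff {e : Set (Euc d)} {f : Euc d → Euc d} :
    InSideSpace r e f ↔ ∃ g ∈ polyVecSpace d r ⊔ rigidMotions d, Set.EqOn f g e := by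
  constructor
  · rintro ⟨p, q, hp, hq, hf⟩
    exact ⟨p + q, Submodule.add_mem_sup hp hq, hf⟩
  · rintro ⟨g, hg, hf⟩
    obtain ⟨p, hp, q, hq, rfl⟩ := Submodule.mem_sup.1 hg
    exact ⟨p, q, hp, hq, hf⟩

lemma IsPolyVec.continuous {u : Euc d → Euc d} (hu : IsPolyVec r u) : Continuous u :=
  (PiLp.continuous_toLp 2 _).comp (continuous_pi fun i => (hu i).continuous)

lemma IsPolyVec.inSideSpace {u : Euc d → Euc d} (hu : IsPolyVec r u) (e : Set (Euc d)) :
    InSideSpace r e u :=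
  inSideSpace_iff.2 ⟨u, Submodule.mem_sup_left hu, fun _ _ => rfl⟩

lemma InSideSpace.continuousOn {e : Set (Euc d)} {f : Euc d → Euc d} (hf : InSideSpace r e f) :
    ContinuousOn f e := by
  obtain ⟨g, hg, hfg⟩ := inSideSpace_iff.1 hf
  exact (IsPolyVec.continuous (polyVecSpace_sup_rigidMotions_le hg)).continuousOn.congr hfg

lemma IsPolyMat.continuous {φ : Euc d → Matrix (Fin d) (Fin d) ℝ} (hφ : IsPolyMat r φ) :
    Continuous φ :=
  continuous_matrix fun i j => (hφ i j).continuous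

lemma IsPolyMat.isPolyVec_apply {φ : Euc d → Matrix (Fin d) (Fin d) ℝ} (hφ : IsPolyMat r φ)
    (n : Euc d) : IsPolyVec r fun x => Matrix.toEuclideanLin (φ x) n := by
  intro i
  have hsum : (fun x => Matrix.toEuclideanLin (φ x) n i) = ∑ j, n j • fun x => φ x i j := by
    ext x
    simp [Matrix.toLpLin_apply, Matrix.mulVec, dotProduct, mul_comm]
  rw [hsum]
  exact (polySpace d r).sum_mem fun j _ => (polySpace d r).smul_mem (n j) (hφ i j)

end FieldSpaces

section InnerProducts

variable {d r : ℕ} {T e : Set (Euc d)}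

/-- A matrix, regarded as a vector of the Euclidean space that carries the Frobenius norm. -/
def matVec : Matrix (Fin d) (Fin d) ℝ →ₗ[ℝ] EuclideanSpace ℝ (Fin d × Fin d) where
  toFun A := WithLp.toLp 2 fun p => A p.1 p.2
  map_add' _ _ := rfl
  map_smul' _ _ := rfl

lemma frob_eq_inner (A B : Matrix (Fin d) (Fin d) ℝ) :
    frob A B = inner ℝ (matVec A) (matVec B) := by
  simp only [frob, PiLp.inner_apply, Fintype.sum_prod_type]
  exact Finset.sum_congr rfl fun i _ => Finset.sum_congr rfl fun j _ => mul_comm _ _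

lemma IsPolyMat.memLp {φ : Euc d → Matrix (Fin d) (Fin d) ℝ} (hφ : IsPolyMat r φ)
    (hT : IsCompact T) : MemLp (fun x => matVec (φ x)) 2 (volume.restrict T) :=
  memLp_restrict_of_isCompact hT hT.measure_lt_top
    ((LinearMap.continuous_of_finiteDimensional matVec).comp hφ.continuous).continuousOn

lemma ipElem_eq_integral_inner (A B : Euc d → Matrix (Fin d) (Fin d) ℝ) :
    ipElem T A B = ∫ x in T, inner ℝ (matVec (A x)) (matVec (B x)) := by
  simp only [ipElem, frob_eq_inner]

lemma ipElem_self_nonneg (T : Set (Euc d)) (A : Euc d → Matrix (Fin d) (Fin d) ℝ) :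
    0 ≤ ipElem T A A := by
  rw [ipElem_eq_integral_inner]
  exact integral_nonneg fun _ => real_inner_self_nonneg

lemma ipSide_self_nonneg (e : Set (Euc d)) (f : Euc d → Euc d) : 0 ≤ ipSide e f f :=
  integral_nonneg fun _ => real_inner_self_nonneg

variable {A B C : Euc d → Matrix (Fin d) (Fin d) ℝ}

lemma IsPolyMat.integrableOn_frob (hA : IsPolyMat r A) (hB : IsPolyMat r B) (hT : IsCompact T) :
    IntegrableOn (fun x => frob (A x) (B x)) T := by
  simp only [frob_eq_inner]
  exact integrable_inner (hA.memLp hT) (hB.memLp hT)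

lemma ipElem_sub_left (hT : IsCompact T) (hA : IsPolyMat r A) (hB : IsPolyMat r B)
    (hC : IsPolyMat r C) : ipElem T (A - B) C = ipElem T A C - ipElem T B C := by
  simp only [ipElem_eq_integral_inner, Pi.sub_apply, map_sub]
  exact integral_inner_sub_left (hA.memLp hT) (hB.memLp hT) (hC.memLp hT)

lemma ipElem_sum_left {ι : Type*} {s : Finset ι} {A : ι → Euc d → Matrix (Fin d) (Fin d) ℝ}
    (hT : IsCompact T) (hA : ∀ i ∈ s, IsPolyMat r (A i)) (hC : IsPolyMat r C) :
    ipElem T (∑ i ∈ s, A i) C = ∑ i ∈ s, ipElem T (A i) C := by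
  simp only [ipElem_eq_integral_inner, Finset.sum_apply, map_sum, sum_inner]
  exact integral_finsetSum _ fun i hi => integrable_inner ((hA i hi).memLp hT) (hC.memLp hT)

lemma frob_self_le (A B : Matrix (Fin d) (Fin d) ℝ) :
    frob A A ≤ 2 * frob B B + 2 * frob (A - B) (A - B) := by
  simp only [frob, Finset.mul_sum, ← Finset.sum_add_distrib]
  refine Finset.sum_le_sum fun i _ => Finset.sum_le_sum fun j _ => ?_
  rw [Matrix.sub_apply]
  nlinarith [sq_nonneg (2 * B i j - A i j)]

lemma ipElem_self_le (hT : IsCompact T) (hA : IsPolyMat r A) (hB : IsPolyMat r B) :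
    ipElem T A A ≤ 2 * ipElem T B B + 2 * ipElem T (A - B) (A - B) := by
  have hAB : IsPolyMat r (A - B) := (polyMatSpace d r).sub_mem hA hB
  have hB2 := (hB.integrableOn_frob hB hT).const_mul 2
  have hAB2 := (hAB.integrableOn_frob hAB hT).const_mul 2
  simp only [ipElem]
  rw [← integral_const_mul, ← integral_const_mul, ← integral_add hB2 hAB2]
  exact integral_mono (hA.integrableOn_frob hA hT) (hB2.add hAB2) fun x => frob_self_le _ _

lemma ipElem_sub_self_comm (A B : Euc d → Matrix (Fin d) (Fin d) ℝ) :
    ipElem T (A - B) (A - B) = ipElem T (B - A) (B - A) := by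
  simp only [ipElem_eq_integral_inner, ← neg_sub A B, Pi.neg_apply, map_neg, inner_neg_neg]

lemma norm_toEuclideanLin_sq_le (A : Matrix (Fin d) (Fin d) ℝ) {n : Euc d} (hn : ‖n‖ = 1) :
    inner ℝ (Matrix.toEuclideanLin A n) (Matrix.toEuclideanLin A n) ≤ frob A A := by
  have hsum : ∑ j, n j ^ 2 = 1 := by rw [← EuclideanSpace.real_norm_sq_eq, hn, one_pow]
  rw [PiLp.inner_apply]
  refine Finset.sum_le_sum fun i _ => ?_
  have hrow := Finset.sum_mul_sq_le_sq_mul_sq Finset.univ (fun j => A i j) (fun j => n j)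
  rw [hsum, mul_one] at hrow
  simpa [Matrix.toLpLin_apply, Matrix.mulVec, dotProduct, ← sq] using hrow

lemma TraceBound.ipSide_apply_le {c : ℝ} (htr : TraceBound r T e c) (hT : IsCompact T)
    (he : IsCompact e) (he' : surf d e < ⊤) (hA : IsPolyMat r A) {n : Euc d} (hn : ‖n‖ = 1) :
    ipSide e (fun x => Matrix.toEuclideanLin (A x) n) (fun x => Matrix.toEuclideanLin (A x) n) ≤
      c * ipElem T A A := by
  have hside {f : Euc d → ℝ} (hf : Continuous f) : IntegrableOn f e (surf d) :=
    memLp_one_iff_integrable.1 (memLp_restrict_of_isCompact he he' hf.continuousOn)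
  have hentry (i j) : Continuous fun x => A x i j ^ 2 := (hA i j).continuous.pow 2
  have hAn := (hA.isPolyVec_apply n).continuous
  calc _ ≤ ∫ x in e, ∑ i, ∑ j, A x i j ^ 2 ∂(surf d) := by
        refine integral_mono (hside (hAn.inner hAn)) (hside ?_) fun x => ?_
        · exact continuous_finsetSum _ fun i _ => continuous_finsetSum _ fun j _ => hentry i j
        · simpa only [frob, ← sq] using norm_toEuclideanLin_sq_le (A x) hn
    _ = ∑ i, ∑ j, ∫ x in e, A x i j ^ 2 ∂(surf d) := integral_sum_sum fun i j => hside (hentry i j)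
    _ ≤ ∑ i, ∑ j, c * ∫ x in T, A x i j ^ 2 :=
        Finset.sum_le_sum fun i _ => Finset.sum_le_sum fun j _ => htr _ (hA i j)
    _ = c * ipElem T A A := by
        simp only [← Finset.mul_sum]
        rw [← integral_sum_sum fun i j => (hentry i j).continuousOn.integrableOn_compact hT]
        simp only [ipElem, frob, sq]

end InnerProducts

section ProjectionAndLifting

variable {d r : ℕ} {T e : Set (Euc d)} {f : Euc d → Euc d}

lemma isSideProj_sideProj (he : IsCompact e) (he' : surf d e < ⊤) (hf : ContinuousOn f e) :
    IsSideProj r e f (sideProj r e f) := by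
  refine Classical.epsilon_spec (p := IsSideProj r e f) ?_
  let W := polyVecSpace d r ⊔ rigidMotions d
  have hL2 {g : Euc d → Euc d} (hg : ContinuousOn g e) : MemLp g 2 ((surf d).restrict e) :=
    memLp_restrict_of_isCompact he he' hg
  have hW (w : W) : MemLp w.1 2 ((surf d).restrict e) :=
    hL2 (IsPolyVec.continuous (polyVecSpace_sup_rigidMotions_le w.2)).continuousOn
  obtain ⟨g, hg⟩ := exists_integral_inner_eq (S := W.subtype) (S' := W.subtype) hW hW
    (fun w => (one_mul _).ge) (hL2 hf)
  refine ⟨g, inSideSpace_iff.2 ⟨g, g.2, fun _ _ => rfl⟩, fun z hz => ?_⟩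
  obtain ⟨w, hw, hzw⟩ := inSideSpace_iff.1 hz
  calc ipSide e (fun x => f x - g.1 x) z = ∫ x in e, inner ℝ ((f - g.1) x) (w x) ∂(surf d) :=
        setIntegral_congr_fun he.measurableSet fun x hx => by rw [hzw hx, Pi.sub_apply]
    _ = 0 := by
        rw [integral_inner_sub_left (hL2 hf) (hW g) (hW ⟨w, hw⟩)]
        exact sub_eq_zero.2 (hg ⟨w, hw⟩).symm

lemma TraceBound.exists_lift {c : ℝ} (htr : TraceBound r T e c) (hT : IsCompact T)
    (he : IsCompact e) (he' : surf d e < ⊤) {n : Euc d} (hn : ‖n‖ = 1) (hf : ContinuousOn f e) :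
    ∃ A, IsPolyMat r A ∧ ∀ φ, IsPolyMat r φ →
      ipElem T A φ = ipSide e f fun x => Matrix.toEuclideanLin (φ x) n := by
  let W := polyMatSpace d r
  have hL2 {g : Euc d → Euc d} (hg : ContinuousOn g e) : MemLp g 2 ((surf d).restrict e) :=
    memLp_restrict_of_isCompact he he' hg
  let normalComponent : Matrix (Fin d) (Fin d) ℝ →ₗ[ℝ] Euc d :=
    LinearMap.applyₗ n ∘ₗ Matrix.toEuclideanLin.toLinearMap
  have hvec (w : W) : MemLp (matVec.compLeft (Euc d) w.1) 2 (volume.restrict T) :=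
    IsPolyMat.memLp w.2 hT
  have hnormal (w : W) : MemLp (normalComponent.compLeft (Euc d) w.1) 2 ((surf d).restrict e) :=
    hL2 (IsPolyMat.isPolyVec_apply w.2 n).continuous.continuousOn
  obtain ⟨A, hA⟩ := exists_integral_inner_eq (S := matVec.compLeft (Euc d) ∘ₗ W.subtype)
    (S' := normalComponent.compLeft (Euc d) ∘ₗ W.subtype) hvec hnormal
    (fun w => (htr.ipSide_apply_le hT he he' w.2 hn).trans_eq
      (congrArg (c * ·) (ipElem_eq_integral_inner _ _))) (hL2 hf)
  exact ⟨A, A.2, fun φ hφ => (ipElem_eq_integral_inner _ _).trans (hA ⟨φ, hφ⟩)⟩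

end ProjectionAndLifting

section IntegrationByParts

variable {d r : ℕ} {T e : Set (Euc d)} {S : Finset (Set (Euc d))} {N : Set (Euc d) → Euc d}
  {u : Euc d → Euc d} {φ : Euc d → Matrix (Fin d) (Fin d) ℝ}

/-- The gradient `∇u` of a vector field, with the entries `∂_j u_i`. -/
def grad (u : Euc d → Euc d) (x : Euc d) : Matrix (Fin d) (Fin d) ℝ :=
  Matrix.of fun i j => pd j (fun y => u y i) x

lemma IsPolyVec.grad (hu : IsPolyVec r u) : IsPolyMat (r - 1) (grad u) :=
  fun i j => (hu i).pd j

lemma continuous_pd {f : Euc d → ℝ} (hf : ContDiff ℝ 1 f) (j : Fin d) : Continuous (pd j f) :=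
  (hf.continuous_fderiv one_ne_zero).clm_apply continuous_const

lemma IsFlatSided.surf_lt_top (h : IsFlatSided T S N) (he : e ∈ S) : surf d e < ⊤ := by
  obtain ⟨p, hp⟩ := h.exists_subset_hyperplane he
  rw [← area_eq_surf]
  exact area_lt_top (h.normal e he).ne_zero hp (h.polytope e he).compact

lemma IsFlatSided.integrableOn_side (h : IsFlatSided T S N) (he : e ∈ S) {f : Euc d → ℝ}
    (hf : Continuous f) : IntegrableOn f e (surf d) :=
  memLp_one_iff_integrable.1
    (memLp_restrict_of_isCompact (h.polytope e he).compact (h.surf_lt_top he) hf.continuousOn)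

lemma IsFlatSided.integral_pd_mul_add (h : IsFlatSided T S N) (j : Fin d) {f g : Euc d → ℝ}
    (hf : ContDiff ℝ 1 f) (hg : ContDiff ℝ 1 g) :
    ∫ x in T, (pd j f x * g x + f x * pd j g x) =
      ∑ e ∈ S, ∫ x in e, f x * (g x * N e j) ∂(surf d) := by
  have hleibniz (x : Euc d) : pd j f x * g x + f x * pd j g x =
      fderiv ℝ (fun y => f y * g y) x (EuclideanSpace.single j 1) := by
    rw [fderiv_fun_mul (hf.differentiable one_ne_zero x) (hg.differentiable one_ne_zero x)]
    simp only [pd, add_apply, smul_apply, smul_eq_mul]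
    ring
  simp only [hleibniz]
  rw [h.integral_fderiv _ (hf.mul hg)]
  simp only [← mul_assoc, integral_mul_const, EuclideanSpace.inner_single_right, conj_trivial,
    one_mul, mul_comm (N _ j)]

lemma inner_toEuclideanLin (w n : Euc d) (A : Matrix (Fin d) (Fin d) ℝ) :
    inner ℝ w (Matrix.toEuclideanLin A n) = ∑ i, ∑ j, w i * (A i j * n j) := by
  simp only [PiLp.inner_apply, RCLike.inner_apply, conj_trivial, Matrix.toLpLin_apply,
    Matrix.mulVec, dotProduct, Finset.mul_sum, mul_comm]

lemma ipElem_grad_add_integral_inner_divMat_eq_sum (hT : IsCompact T)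
    (hu : ∀ i, ContDiff ℝ 1 fun x => u x i) (hφ : ∀ i j, ContDiff ℝ 1 fun x => φ x i j) :
    ipElem T (grad u) φ + ∫ x in T, inner ℝ (u x) (divMat φ x) = ∑ i, ∑ j, ∫ x in T,
      (pd j (fun y => u y i) x * φ x i j + u x i * pd j (fun y => φ y i j) x) := by
  have hgrad (i j) : IntegrableOn (fun x => pd j (fun y => u y i) x * φ x i j) T :=
    ((continuous_pd (hu i) j).mul (hφ i j).continuous).continuousOn.integrableOn_compact hT
  have hdiv (i j) : IntegrableOn (fun x => u x i * pd j (fun y => φ y i j) x) T :=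
    ((hu i).continuous.mul (continuous_pd (hφ i j) j)).continuousOn.integrableOn_compact hT
  have hinner (x : Euc d) : inner ℝ (u x) (divMat φ x) =
      ∑ i, ∑ j, u x i * pd j (fun y => φ y i j) x := by
    simp only [divMat, PiLp.inner_apply, RCLike.inner_apply, conj_trivial, Finset.mul_sum,
      mul_comm]
  simp only [ipElem, frob, grad, Matrix.of_apply, hinner]
  rw [integral_sum_sum hgrad, integral_sum_sum hdiv]
  simp only [← Finset.sum_add_distrib]
  exact Finset.sum_congr rfl fun i _ => Finset.sum_congr rfl fun j _ =>
    (integral_add (hgrad i j) (hdiv i j)).symm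

theorem IsFlatSided.ipElem_grad_add_integral_inner_divMat (h : IsFlatSided T S N)
    (hu : ∀ i, ContDiff ℝ 1 fun x => u x i) (hφ : ∀ i j, ContDiff ℝ 1 fun x => φ x i j) :
    ipElem T (grad u) φ + ∫ x in T, inner ℝ (u x) (divMat φ x) =
      ∑ e ∈ S, ipSide e u fun x => Matrix.toEuclideanLin (φ x) (N e) := by
  have hside (e) (he : e ∈ S) : ipSide e u (fun x => Matrix.toEuclideanLin (φ x) (N e)) =
      ∑ i, ∑ j, ∫ x in e, u x i * (φ x i j * N e j) ∂(surf d) := by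
    simp only [ipSide, inner_toEuclideanLin]
    exact integral_sum_sum fun i j => h.integrableOn_side he
      ((hu i).continuous.mul ((hφ i j).continuous.mul continuous_const))
  calc _ = ∑ i, ∑ j, ∑ e ∈ S, ∫ x in e, u x i * (φ x i j * N e j) ∂(surf d) := by
        rw [ipElem_grad_add_integral_inner_divMat_eq_sum h.compact hu hφ]
        exact Finset.sum_congr rfl fun i _ => Finset.sum_congr rfl fun j _ =>
          h.integral_pd_mul_add j (hu i) (hφ i j)
    _ = ∑ e ∈ S, ∑ i, ∑ j, ∫ x in e, u x i * (φ x i j * N e j) ∂(surf d) := by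
        rw [Finset.sum_congr rfl fun i _ => Finset.sum_comm, Finset.sum_comm]
    _ = _ := (Finset.sum_congr rfl hside).symm

end IntegrationByParts

section WeakGradient

variable {d r : ℕ} {T e : Set (Euc d)} {M : Mesh d} {v : WeakFun d} {c : ℝ}

lemma ipSide_sub_left {f g w : Euc d → Euc d} (he : IsCompact e) (he' : surf d e < ⊤)
    (hf : ContinuousOn f e) (hg : ContinuousOn g e) (hw : ContinuousOn w e) :
    ipSide e (f - g) w = ipSide e f w - ipSide e g w :=
  integral_inner_sub_left (memLp_restrict_of_isCompact he he' hf)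
    (memLp_restrict_of_isCompact he he' hg) (memLp_restrict_of_isCompact he he' hw)

lemma IsFlatSided.isWeakGrad_iff (h : IsFlatSided T (M.sidesOf T) (outwardNormal T))
    (hu : IsPolyVec (r + 1) (v.inn T)) (hb : ∀ e ∈ M.sidesOf T, ContinuousOn (v.bdy e) e)
    {G : Euc d → Matrix (Fin d) (Fin d) ℝ} :
    IsWeakGrad r M T v G ↔ IsPolyMat r G ∧ ∀ φ, IsPolyMat r φ →
      ipElem T (G - grad (v.inn T)) φ = ∑ e ∈ M.sidesOf T, ipSide e (v.bdy e - v.inn T)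
        fun x => Matrix.toEuclideanLin (φ x) (outwardNormal T e) := by
  refine and_congr_right fun hG => forall₂_congr fun φ hφ => ?_
  have hparts := h.ipElem_grad_add_integral_inner_divMat (fun i => (hu i).contDiff)
    (fun i j => (hφ i j).contDiff)
  rw [ipElem_sub_left h.compact hG hu.grad hφ, Finset.sum_congr rfl fun e he =>
    ipSide_sub_left (h.polytope e he).compact (h.surf_lt_top he) (hb e he)
      hu.continuous.continuousOn (hφ.isPolyVec_apply _).continuous.continuousOn,
    Finset.sum_sub_distrib, ← hparts]
  constructor <;> intro hG <;> linarith

lemma IsFlatSided.isWeakGrad_weakGrad (h : IsFlatSided T (M.sidesOf T) (outwardNormal T))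
    (htr : ∀ e ∈ M.sidesOf T, TraceBound r T e c) (hu : IsPolyVec (r + 1) (v.inn T))
    (hb : ∀ e ∈ M.sidesOf T, ContinuousOn (v.bdy e) e) :
    IsWeakGrad r M T v (weakGrad r M v T) := by
  choose! ℓ hℓ hℓφ using fun e (he : e ∈ M.sidesOf T) =>
    (htr e he).exists_lift h.compact (h.polytope e he).compact (h.surf_lt_top he)
      (h.normal e he).1 ((hb e he).sub hu.continuous.continuousOn)
  refine Classical.epsilon_spec (p := IsWeakGrad r M T v)
    ⟨grad (v.inn T) + ∑ e ∈ M.sidesOf T, ℓ e, (h.isWeakGrad_iff hu hb).2 ⟨?_, fun φ hφ => ?_⟩⟩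
  · exact (polyMatSpace d r).add_mem hu.grad ((polyMatSpace d r).sum_mem hℓ)
  · rw [add_sub_cancel_left, ipElem_sum_left h.compact hℓ hφ]
    exact Finset.sum_congr rfl fun e he => hℓφ e he φ hφ

lemma IsFlatSided.ipSide_bdy_sub_inn (h : IsFlatSided T (M.sidesOf T) (outwardNormal T))
    (he : e ∈ M.sidesOf T) (hu : ContinuousOn (v.inn T) e) (hb : ContinuousOn (v.bdy e) e)
    {w : Euc d → Euc d} (hw : InSideSpace r e w) :
    ipSide e (v.bdy e - v.inn T) w = -ipSide e (jump (r + 1) v T e) w := by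
  have hec := (h.polytope e he).compact
  have he' := h.surf_lt_top he
  have hproj := isSideProj_sideProj (r := r) hec he' hu
  have hq := hproj.1.continuousOn
  have horth : ipSide e (v.inn T - sideProj r e (v.inn T)) w = 0 := hproj.2 w hw
  have hjump : jump (r + 1) v T e = sideProj r e (v.inn T) - v.bdy e := rfl
  rw [ipSide_sub_left hec he' hu hq hw.continuousOn] at horth
  rw [hjump, ipSide_sub_left hec he' hb hu hw.continuousOn,
    ipSide_sub_left hec he' hq hb hw.continuousOn]
  linarith

lemma IsFlatSided.ipElem_weakGrad_sub_grad (h : IsFlatSided T (M.sidesOf T) (outwardNormal T))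
    (htr : ∀ e ∈ M.sidesOf T, TraceBound r T e c) (hu : IsPolyVec (r + 1) (v.inn T))
    (hb : ∀ e ∈ M.sidesOf T, ContinuousOn (v.bdy e) e)
    {φ : Euc d → Matrix (Fin d) (Fin d) ℝ} (hφ : IsPolyMat r φ) :
    ipElem T (weakGrad r M v T - grad (v.inn T)) φ =
      ∑ e ∈ M.sidesOf T, -ipSide e (jump (r + 1) v T e)
        fun x => Matrix.toEuclideanLin (φ x) (outwardNormal T e) := by
  rw [((h.isWeakGrad_iff hu hb).1 (h.isWeakGrad_weakGrad htr hu hb)).2 φ hφ]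
  exact Finset.sum_congr rfl fun e he => h.ipSide_bdy_sub_inn he hu.continuous.continuousOn
    (hb e he) ((hφ.isPolyVec_apply _).inSideSpace e)

lemma le_of_eq_sum_of_sq_le {ι : Type*} {s : Finset ι} {a J : ι → ℝ} {X : ℝ} (hX : 0 ≤ X)
    (hc : 0 ≤ c) (hJ : ∀ i ∈ s, 0 ≤ J i) (hsum : X = ∑ i ∈ s, a i)
    (hle : ∀ i ∈ s, a i ^ 2 ≤ J i * (c * X)) : X ≤ s.card * c * ∑ i ∈ s, J i := by
  rcases hX.eq_or_lt with rfl | hX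
  · have := Finset.sum_nonneg hJ
    positivity
  refine le_of_mul_le_mul_right ?_ hX
  calc X * X = (∑ i ∈ s, a i) ^ 2 := by rw [← hsum, sq]
    _ ≤ s.card * ∑ i ∈ s, a i ^ 2 := sq_sum_le_card_mul_sum_sq
    _ ≤ s.card * ∑ i ∈ s, J i * (c * X) := by gcongr with i hi; exact hle i hi
    _ = s.card * c * (∑ i ∈ s, J i) * X := by rw [← Finset.sum_mul]; ring

theorem IsFlatSided.ipElem_weakGrad_sub_grad_self_le
    (h : IsFlatSided T (M.sidesOf T) (outwardNormal T)) (hc : 0 ≤ c)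
    (htr : ∀ e ∈ M.sidesOf T, TraceBound r T e c) (hu : IsPolyVec (r + 1) (v.inn T))
    (hb : ∀ e ∈ M.sidesOf T, InSideSpace r e (v.bdy e)) :
    ipElem T (weakGrad r M v T - grad (v.inn T)) (weakGrad r M v T - grad (v.inn T)) ≤
      (M.sidesOf T).card * c *
        ∑ e ∈ M.sidesOf T, ipSide e (jump (r + 1) v T e) (jump (r + 1) v T e) := by
  have hbc (e) (he : e ∈ M.sidesOf T) : ContinuousOn (v.bdy e) e := (hb e he).continuousOn
  have hE : IsPolyMat r (weakGrad r M v T - grad (v.inn T)) :=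
    (polyMatSpace d r).sub_mem (h.isWeakGrad_weakGrad htr hu hbc).1 hu.grad
  refine le_of_eq_sum_of_sq_le (ipElem_self_nonneg _ _) hc (fun e _ => ipSide_self_nonneg _ _)
    (h.ipElem_weakGrad_sub_grad htr hu hbc hE) fun e he => ?_
  have hec := (h.polytope e he).compact
  have he' := h.surf_lt_top he
  have hjump : ContinuousOn (jump (r + 1) v T e) e :=
    (isSideProj_sideProj (r := r) hec he' hu.continuous.continuousOn).1.continuousOn.sub (hbc e he)
  have hEn := (hE.isPolyVec_apply (outwardNormal T e)).continuous.continuousOn (s := e)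
  rw [neg_sq]
  exact (sq_integral_inner_le (memLp_restrict_of_isCompact hec he' hjump)
    (memLp_restrict_of_isCompact hec he' hEn)).trans (mul_le_mul_of_nonneg_left
      ((htr e he).ipSide_apply_le h.compact hec he' hE (h.normal e he).1)
      (ipSide_self_nonneg _ _))

end WeakGradient

section Strain

variable {d r : ℕ} {T : Set (Euc d)}

/-- The symmetric part of a matrix, so that `ε(u) = symmPart (∇u)`. -/
def symmPart (A : Matrix (Fin d) (Fin d) ℝ) : Matrix (Fin d) (Fin d) ℝ :=
  (1 / 2 : ℝ) • (A + Aᵀ)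

lemma strain_eq_symmPart_grad (u : Euc d → Euc d) : strain u = fun x => symmPart (grad u x) := by
  ext x i j
  simp only [strain, symmPart, grad, Matrix.of_apply, Matrix.smul_apply, Matrix.add_apply,
    Matrix.transpose_apply, smul_eq_mul]
  ring

lemma symmPart_sub (A B : Matrix (Fin d) (Fin d) ℝ) :
    symmPart (A - B) = symmPart A - symmPart B := by
  rw [symmPart, symmPart, symmPart, Matrix.transpose_sub, ← smul_sub, add_sub_add_comm]

lemma IsPolyMat.symmPart {A : Euc d → Matrix (Fin d) (Fin d) ℝ} (hA : IsPolyMat r A) :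
    IsPolyMat r fun x => symmPart (A x) := fun i j =>
  (polySpace d r).smul_mem _ ((polySpace d r).add_mem (hA i j) (hA j i))

lemma frob_symmPart_self_le (A : Matrix (Fin d) (Fin d) ℝ) :
    frob (symmPart A) (symmPart A) ≤ frob A A := by
  have hentry (i j : Fin d) :
      symmPart A i j * symmPart A i j ≤ (A i j * A i j + A j i * A j i) / 2 := by
    simp only [symmPart, Matrix.smul_apply, Matrix.add_apply, Matrix.transpose_apply, smul_eq_mul]
    nlinarith [sq_nonneg (A i j - A j i)]
  calc frob (symmPart A) (symmPart A) ≤ ∑ i, ∑ j, (A i j * A i j + A j i * A j i) / 2 :=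
        Finset.sum_le_sum fun i _ => Finset.sum_le_sum fun j _ => hentry i j
    _ = frob A A := by
        have hcomm : ∑ i, ∑ j, A j i * A j i = frob A A := Finset.sum_comm
        simp only [← Finset.sum_div, Finset.sum_add_distrib, hcomm]
        rw [← frob, add_self_div_two]

lemma ipElem_symmPart_self_le {A : Euc d → Matrix (Fin d) (Fin d) ℝ} (hT : IsCompact T)
    (hA : IsPolyMat r A) :
    ipElem T (fun x => symmPart (A x)) (fun x => symmPart (A x)) ≤ ipElem T A A :=
  integral_mono (hA.symmPart.integrableOn_frob hA.symmPart hT) (hA.integrableOn_frob hA hT)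
    fun x => frob_symmPart_self_le (A x)

end Strain

section Comparison

variable {d r : ℕ} {T : Set (Euc d)} {S : Finset (Set (Euc d))} {N : Set (Euc d) → Euc d}
  {M : Mesh d} {v : WeakFun d}

lemma IsFlatSided.ipElem_weakStrain_sub_strain_self_le
    (h : IsFlatSided T (M.sidesOf T) (outwardNormal T)) {c : ℝ}
    (htr : ∀ e ∈ M.sidesOf T, TraceBound r T e c) (hu : IsPolyVec (r + 1) (v.inn T))
    (hb : ∀ e ∈ M.sidesOf T, InSideSpace r e (v.bdy e)) :
    ipElem T (weakStrain r M v T - strain (v.inn T)) (weakStrain r M v T - strain (v.inn T)) ≤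
      ipElem T (weakGrad r M v T - grad (v.inn T)) (weakGrad r M v T - grad (v.inn T)) := by
  have hstrain : weakStrain r M v T - strain (v.inn T) =
      fun x => symmPart ((weakGrad r M v T - grad (v.inn T)) x) := by
    rw [strain_eq_symmPart_grad]
    exact funext fun x => (symmPart_sub _ _).symm
  have hG := (h.isWeakGrad_weakGrad htr hu fun e he => (hb e he).continuousOn).1
  rw [hstrain]
  exact ipElem_symmPart_self_le h.compact ((polyMatSpace d r).sub_mem hG hu.grad)

/-- Each `e ∈ S` is the base of a pyramid contained in `T`, of height at least `η`, where heights
are measured along the normal `N e`. -/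
def HasPyramids (T : Set (Euc d)) (S : Finset (Set (Euc d))) (N : Set (Euc d) → Euc d)
    (η : ℝ) : Prop :=
  ∀ e ∈ S, ∃ A, ∃ H ≥ η, convexJoin ℝ {A} e ⊆ T ∧ ∀ x ∈ e, inner ℝ (N e) (x - A) = H

lemma exists_traceBound_of_hasPyramids (d r : ℕ) : ∃ C : ℝ, 0 ≤ C ∧
    ∀ {T : Set (Euc d)} {S : Finset (Set (Euc d))} {N : Set (Euc d) → Euc d} {η : ℝ},
      IsFlatSided T S N → 0 < η → HasPyramids T S N η → ∀ e ∈ S, TraceBound r T e (C / η) := by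
  obtain ⟨C, hC, htr⟩ := exists_traceBound_of_pyramid d r
  refine ⟨C, hC, fun h hη hpyr e he => ?_⟩
  obtain ⟨A, H, hH, hsub, hbase⟩ := hpyr e he
  exact (htr h.compact (h.polytope e he).compact (h.normal e he).1 (hη.trans_le hH) hbase hsub).mono
    (div_le_div_of_nonneg_left hC hη hH)

lemma IsFlatSided.size_pos (h : IsFlatSided T S N) {e : Set (Euc d)} (he : e ∈ S) :
    0 < size T := by
  obtain ⟨x, hx⟩ := (h.polytope e he).connected.nonempty
  obtain ⟨δ, hδ, hmem⟩ := (h.normal e he).2.2 x hx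
  have hx' : x - (δ / 2) • N e ∈ T := (hmem (δ / 2) (by positivity) (by linarith)).1
  refine lt_of_lt_of_le ?_ (Metric.dist_le_diam_of_mem h.compact.isBounded
    (h.subset he (intrinsicInterior_subset hx)) hx')
  rw [dist_self_sub_right, norm_smul, (h.normal e he).1, mul_one]
  exact norm_pos_iff.2 (by positivity)

/-- The contribution of the element `T` to the stabilizer `s(v, v)`. -/
def localStab (k : ℕ) (M : Mesh d) (v : WeakFun d) (T : Set (Euc d)) : ℝ :=
  (size T)⁻¹ * ∑ e ∈ M.sidesOf T, ipSide e (jump k v T e) (jump k v T e)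

lemma localStab_nonneg (k : ℕ) (M : Mesh d) (v : WeakFun d) (T : Set (Euc d)) :
    0 ≤ localStab k M v T :=
  mul_nonneg (inv_nonneg.2 Metric.diam_nonneg) (Finset.sum_nonneg fun _ _ => ipSide_self_nonneg _ _)

theorem exists_ipElem_weakStrain_sub_strain_self_le (d r n : ℕ) {σ : ℝ} (hσ : 0 < σ) :
    ∃ K : ℝ, 0 ≤ K ∧ ∀ {T : Set (Euc d)} {M : Mesh d} {v : WeakFun d},
      IsFlatSided T (M.sidesOf T) (outwardNormal T) →
      HasPyramids T (M.sidesOf T) (outwardNormal T) (σ * size T) →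
      (M.sidesOf T).card ≤ n → IsPolyVec (r + 1) (v.inn T) →
      (∀ e ∈ M.sidesOf T, InSideSpace r e (v.bdy e)) →
      IsPolyMat r (weakStrain r M v T) ∧
      ipElem T (weakStrain r M v T - strain (v.inn T)) (weakStrain r M v T - strain (v.inn T)) ≤
        K * localStab (r + 1) M v T := by
  obtain ⟨C, hC, hCtr⟩ := exists_traceBound_of_hasPyramids d r
  refine ⟨n * C / σ, by positivity, fun {T M v} h hpyr hcard hu hb => ?_⟩
  have htr (e) (he : e ∈ M.sidesOf T) : TraceBound r T e (C / (σ * size T)) :=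
    hCtr h (mul_pos hσ (h.size_pos he)) hpyr e he
  have hc : 0 ≤ C / (σ * size T) := div_nonneg hC (mul_nonneg hσ.le Metric.diam_nonneg)
  have hJ : 0 ≤ ∑ e ∈ M.sidesOf T, ipSide e (jump (r + 1) v T e) (jump (r + 1) v T e) :=
    Finset.sum_nonneg fun _ _ => ipSide_self_nonneg _ _
  refine ⟨(h.isWeakGrad_weakGrad htr hu fun e he => (hb e he).continuousOn).1.symmPart, ?_⟩
  calc _ ≤ ipElem T (weakGrad r M v T - grad (v.inn T)) (weakGrad r M v T - grad (v.inn T)) :=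
        h.ipElem_weakStrain_sub_strain_self_le htr hu hb
    _ ≤ (M.sidesOf T).card * (C / (σ * size T)) *
          ∑ e ∈ M.sidesOf T, ipSide e (jump (r + 1) v T e) (jump (r + 1) v T e) :=
        h.ipElem_weakGrad_sub_grad_self_le hc htr hu hb
    _ ≤ n * (C / (σ * size T)) *
          ∑ e ∈ M.sidesOf T, ipSide e (jump (r + 1) v T e) (jump (r + 1) v T e) := by
        gcongr
    _ = n * C / σ * localStab (r + 1) M v T := by
        rw [localStab, div_mul_eq_div_div]
        ring

lemma tripleNorm_sq (k : ℕ) (M : Mesh d) (v : WeakFun d) : tripleNorm k M v ^ 2 =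
    ∑ T ∈ M.elements, (ipElem T (strain (v.inn T)) (strain (v.inn T)) + localStab k M v T) :=
  Real.sq_sqrt (Finset.sum_nonneg fun T _ =>
    add_nonneg (ipElem_self_nonneg _ _) (localStab_nonneg k M v T))

lemma ipElem_smul_left (a : ℝ) (A B : Euc d → Matrix (Fin d) (Fin d) ℝ) :
    ipElem T (fun x => a • A x) B = a * ipElem T A B := by
  simp only [ipElem_eq_integral_inner, map_smul, real_inner_smul_left, integral_const_mul]

lemma bilinA_self (k : ℕ) (μ : ℝ) (M : Mesh d) (v : WeakFun d) : bilinA k μ M v v =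
    ∑ T ∈ M.elements, (2 * μ * ipElem T (weakStrain (k - 1) M v T) (weakStrain (k - 1) M v T) +
      localStab k M v T) := by
  simp only [bilinA, stab, ipElem_smul_left, Finset.mul_sum, Finset.sum_add_distrib, mul_assoc,
    localStab]

lemma min_mul_add_le_and_le {μ K W E J : ℝ} (hμ : 0 < μ) (hK : 0 ≤ K) (hE : 0 ≤ E)
    (hW : 0 ≤ W) (hJ : 0 ≤ J) (hWE : W ≤ 2 * E + 2 * (K * J)) (hEW : E ≤ 2 * W + 2 * (K * J)) :
    min μ (1 / (2 * K + 1)) * (E + J) ≤ 2 * μ * W + J ∧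
      2 * μ * W + J ≤ (4 * μ + 4 * μ * K + 1) * (E + J) := by
  constructor
  · have hmin : 0 ≤ min μ (1 / (2 * K + 1)) := le_min hμ.le (by positivity)
    calc min μ (1 / (2 * K + 1)) * (E + J)
        ≤ min μ (1 / (2 * K + 1)) * (2 * W + (2 * K + 1) * J) :=
          mul_le_mul_of_nonneg_left (by linarith) hmin
      _ ≤ μ * (2 * W) + 1 / (2 * K + 1) * ((2 * K + 1) * J) := by
          rw [mul_add]
          gcongr
          exacts [min_le_left _ _, min_le_right _ _]
      _ = 2 * μ * W + J := by field_simp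
  · have hscaled := mul_le_mul_of_nonneg_left hWE (show 0 ≤ 2 * μ by positivity)
    have hKE : 0 ≤ μ * K * E := by positivity
    have hμJ : 0 ≤ μ * J := by positivity
    linarith

lemma Mesh.mem_sides_of_mem_sidesOf {e : Set (Euc d)} (he : e ∈ M.sidesOf T) : e ∈ M.sides := by
  classical
  exact (Finset.mem_filter.1 he).1

lemma Mesh.IsPartition.isFlatSided {Ω : Set (Euc d)} (hM : M.IsPartition Ω) (hT : T ∈ M.elements) :
    IsFlatSided T (M.sidesOf T) (outwardNormal T) where
  compact := (hM.elements_polytope T hT).compact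
  frontier_eq := hM.frontier_eq T hT
  polytope e he := hM.sides_polytope e (Mesh.mem_sides_of_mem_sidesOf he)
  disjoint e he e' he' := hM.sides_disjoint e (Mesh.mem_sides_of_mem_sidesOf he) e'
    (Mesh.mem_sides_of_mem_sidesOf he')
  normal e he := Classical.epsilon_spec (hM.exists_normal T hT e he)

lemma Mesh.ShapeRegular.hasPyramids {c : ShapeConstants} (hM : M.ShapeRegular c)
    (hT : T ∈ M.elements) :
    HasPyramids T (M.sidesOf T) (outwardNormal T) (c.sigma * size T) := fun e he => by
  obtain ⟨A, -, σ, hσ, hsub, hbase⟩ := hM.pyramid T hT e he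
  exact ⟨A, σ * size T, mul_le_mul_of_nonneg_right hσ Metric.diam_nonneg, hsub,
    fun x hx => (hbase x hx).1⟩

end Comparison

end WG

end

theorem mainTheorem6_general (d k N : ℕ) {μ σ : ℝ} (hμ : 0 < μ) (hσ : 0 < σ) :
    ∃ α₁ α₂ : ℝ, 0 < α₁ ∧ 0 < α₂ ∧ ∀ M : WG.Mesh d,
      (∀ T ∈ M.elements, WG.IsFlatSided T (M.sidesOf T) (WG.outwardNormal T)) →
      (∀ T ∈ M.elements,
        WG.HasPyramids T (M.sidesOf T) (WG.outwardNormal T) (σ * WG.size T)) →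
      (∀ T ∈ M.elements, (M.sidesOf T).card ≤ N) →
      ∀ v : WG.WeakFun d, WG.InV (k + 1) M v →
        α₁ * WG.tripleNorm (k + 1) M v ^ 2 ≤ WG.bilinA (k + 1) μ M v v ∧
          WG.bilinA (k + 1) μ M v v ≤ α₂ * WG.tripleNorm (k + 1) M v ^ 2 := by
  obtain ⟨K, hK, hclose⟩ := WG.exists_ipElem_weakStrain_sub_strain_self_le d k N hσ
  refine ⟨min μ (1 / (2 * K + 1)), 4 * μ + 4 * μ * K + 1, by positivity, by positivity,
    fun M hflat hpyr hcard v hv => ?_⟩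
  rw [WG.tripleNorm_sq, WG.bilinA_self, Finset.mul_sum, Finset.mul_sum, Nat.add_sub_cancel]
  have hlocal (T) (hT : T ∈ M.elements) := by
    obtain ⟨hW, hle⟩ := hclose (hflat T hT) (hpyr T hT) (hcard T hT) (hv.1 T hT)
      fun e he => hv.2 e (WG.Mesh.mem_sides_of_mem_sidesOf he)
    have hE : WG.IsPolyMat k (WG.strain (v.inn T)) := by
      rw [WG.strain_eq_symmPart_grad]
      exact (hv.1 T hT).grad.symmPart
    have hWE := WG.ipElem_self_le (hflat T hT).compact hW hE
    have hEW := WG.ipElem_self_le (hflat T hT).compact hE hW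
    rw [WG.ipElem_sub_self_comm] at hEW
    exact WG.min_mul_add_le_and_le hμ hK (WG.ipElem_self_nonneg _ _) (WG.ipElem_self_nonneg _ _)
      (WG.localStab_nonneg _ M v T) (hWE.trans (by linarith)) (hEW.trans (by linarith))
  exact ⟨Finset.sum_le_sum fun T hT => (hlocal T hT).1,
    Finset.sum_le_sum fun T hT => (hlocal T hT).2⟩

theorem mainTheorem6 (d : ℕ) (hd : d = 2 ∨ d = 3) (k : ℕ) (hk : 1 ≤ k) (μ : ℝ) (hμ : 0 < μ)
    (c : WG.ShapeConstants) (N : ℕ) :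
    ∃ α₁ α₂ : ℝ, 0 < α₁ ∧ 0 < α₂ ∧
      ∀ (Ω : Set (WG.Euc d)), IsOpen Ω → Bornology.IsBounded Ω → IsConnected Ω →
        WG.HasLipschitzBoundary Ω →
      ∀ (M : WG.Mesh d), M.IsPartition Ω → M.ShapeRegular c →
        (∀ T ∈ M.elements, (M.sidesOf T).card ≤ N) →
      ∀ v : WG.WeakFun d, WG.InV0 k Ω M v →
        α₁ * WG.tripleNorm k M v ^ 2 ≤ WG.bilinA k μ M v v ∧
          WG.bilinA k μ M v v ≤ α₂ * WG.tripleNorm k M v ^ 2 := by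
  obtain ⟨k, rfl⟩ := Nat.exists_eq_add_of_le' hk
  obtain ⟨α₁, α₂, h₁, h₂, h⟩ := mainTheorem6_general d k N hμ c.sigma_pos
  exact ⟨α₁, α₂, h₁, h₂, fun Ω _ _ _ _ M hM hreg hN v hv =>
    h M (fun T hT => hM.isFlatSided hT) (fun T hT => hreg.hasPyramids hT) hN v hv.1⟩
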